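/- Let $G$ be a cubic graph, i.e. a finite simple graph with $n\ge 1$ vertices, each of degree $3$ ($G$ need not be connected), and let $\lambda_1,\dots,\lambda_n$ be the eigenvalues of its adjacency matrix, listed with multiplicity. Consider oriented closed paths $(v_1,\dots,v_\ell,v_1)$ in $G$ (consecutive vertices adjacent; constant paths have length $0$) up to cyclic permutation of the vertices; the length is the number $\ell$ of edges. An elementary homotopy is $(v_1,\dots,v_j,\dots,v_\ell,v_1)\mapsto(v_1,\dots,v_j,v',v_j,\dots,v_\ell,v_1)$ with $v'$ adjacent to $v_j$, and two closed paths are freely homotopic if they are connected by a finite sequence of elementary homotopies and their inverses. A closed geodesic is a closed path of positive length that is shortest in its free homotopy class; it is primitive if it is not a power of a shorter closed geodesic. Let $m_\ell$ be the number of non-oriented primitive closed geodesics of length $\ell$ (a geodesic and its reverse being identified). For $t\in\mathbb R$ put $$J(t)=\frac{3}{2\pi}\int_{-2\sqrt2}^{2\sqrt2}e^{st}\,\frac{\sqrt{8-s^2}}{9-s^2}\,ds,\qquad F_\ell(t)=\sum_{k=1}^\infty\frac{I_{k\ell}(2\sqrt2\,t)}{2^{k\ell/2}},\qquad I_m(z)=\sum_{r=0}^\infty\frac{(z/2)^{m+2r}}{r!\,(m+r)!}.$$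 Then every closed geodesic has length at least $3$, every $m_\ell$ is finite, the integrand of $J(t)$ is integrable, the series for $I_m(z)$ ($m\ge0$, $z\in\mathbb R$) and for $F_\ell(t)$ ($\ell\ge3$) and the series $\sum_{\ell\ge3}\ell m_\ell F_\ell(t)$ converge absolutely, and for every $t\in\mathbb R$ $$\frac1n\sum_{i=1}^n e^{t\lambda_i}=J(t)+\frac2n\sum_{\ell=3}^\infty \ell\, m_\ell\, F_\ell(t).$$ In particular the mean $\mu=\frac1n\sum_{i=1}^n e^{\lambda_i/3}$ is $$\mu=J(1/3)+\frac2n\sum_{\ell=3}^\infty \ell\, m_\ell\, F_\ell(1/3),$$ and the variance $\sigma=\frac1n\sum_{i=1}^n\left(e^{\lambda_i/3}-\mu\right)^2$ is $$\sigma=J(2/3)+\frac2n\sum_{\ell=3}^\infty \ell\, m_\ell\, F_\ell(2/3)-\mu^2 =\left(J(2/3)-J(1/3)^2\right)+\frac2n\sum_{\ell=3}^\infty \ell\, m_\ell\left(F_\ell(2/3)-2J(1/3)F_\ell(1/3)\right)-\left(\frac2n\sum_{\ell=3}^\infty \ell\, m_\ell\, F_\ell(1/3)\right)^2 .$$ 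-/

import Mathlib

open scoped Nat

noncomputable section

namespace CubicTrace

universe u

variable {V : Type u}

/-- A closed path with a distinguished starting vertex: `(v₁, v₂, …, v_ℓ, v₁)`. -/
abbrev BasedClosedPath (G : SimpleGraph V) : Type u := Σ v : V, G.Walk v v

/-- Cyclic permutation: the closed path `p · q` is started at the end point of `p` instead. -/
inductive IsRotation (G : SimpleGraph V) : BasedClosedPath G → BasedClosedPath G → Prop
  | mk {u v : V} (p : G.Walk u v) (q : G.Walk v u) :
      IsRotation G ⟨u, p.append q⟩ ⟨v, q.append p⟩

/-- Oriented closed paths in `G`, up to cyclic permutation of their vertices. -/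
def ClosedPath (G : SimpleGraph V) : Type u := Quot (IsRotation G)

namespace ClosedPath

variable {G : SimpleGraph V}

/-- The oriented closed path traced out by a closed walk. -/
def ofWalk {v : V} (p : G.Walk v v) : ClosedPath G := Quot.mk _ ⟨v, p⟩

/-- The number of edges of a closed path. -/
def length : ClosedPath G → ℕ :=
  Quot.lift (fun p => p.2.length) (by
    rintro _ _ ⟨p, q⟩
    simp [SimpleGraph.Walk.length_append, Nat.add_comm])

/-- The same closed path with the opposite orientation. -/
def reverse : ClosedPath G → ClosedPath G :=
  Quot.map (fun p => ⟨p.1, p.2.reverse⟩) (by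
    rintro _ _ ⟨p, q⟩
    simpa [SimpleGraph.Walk.reverse_append] using IsRotation.mk q.reverse p.reverse)

/-- An elementary homotopy inserts a detour `v, v', v` to a neighbour `v'` of a vertex `v`
of the path (the vertex `v` being the end point of `p` below). -/
inductive ElementaryHomotopy : ClosedPath G → ClosedPath G → Prop
  | mk {u v v' : V} (p : G.Walk u v) (q : G.Walk v u) (h : G.Adj v v') :
      ElementaryHomotopy (ofWalk (p.append q))
        (ofWalk (p.append (.cons h (.cons h.symm q))))

/-- Free homotopy: a finite sequence of elementary homotopies and their inverses. -/
def FreelyHomotopic : ClosedPath G → ClosedPath G → Prop :=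
  Relation.EqvGen ElementaryHomotopy

/-- A closed geodesic is a closed path that is shortest in its free homotopy class; the constant
paths (length `0`), which represent the trivial class, are not counted. -/
def IsClosedGeodesic (γ : ClosedPath G) : Prop :=
  0 < γ.length ∧ ∀ γ' : ClosedPath G, FreelyHomotopic γ γ' → γ.length ≤ γ'.length

/-- The closed walk `p` run through `k` times. -/
def walkPow {v : V} (p : G.Walk v v) : ℕ → G.Walk v v
  | 0 => .nil
  | k + 1 => p.append (walkPow p k)

/-- `γ` is a power of `δ`: it runs `k` times through `δ`, from some starting vertex of `δ`. -/
def IsPowerOf (γ δ : ClosedPath G) : Prop :=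
  ∃ (v : V) (p : G.Walk v v) (k : ℕ), δ = ofWalk p ∧ γ = ofWalk (walkPow p k)

/-- A closed geodesic is primitive if it is not a power of a shorter closed geodesic. -/
def IsPrimitiveGeodesic (γ : ClosedPath G) : Prop :=
  IsClosedGeodesic γ ∧
    ¬ ∃ δ : ClosedPath G, IsClosedGeodesic δ ∧ δ.length < γ.length ∧ IsPowerOf γ δ

end ClosedPath

/-- The oriented primitive closed geodesics of length `ℓ` in `G`. -/
def primitiveGeodesics (G : SimpleGraph V) (ℓ : ℕ) : Set (ClosedPath G) :=
  {γ | γ.IsPrimitiveGeodesic ∧ γ.length = ℓ}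

/-- The multiplicity `m_ℓ`: the number of non-oriented primitive closed geodesics of length `ℓ`,
a non-oriented geodesic being an unordered pair `{γ, γ⁻¹}`. -/
def multiplicity (G : SimpleGraph V) (ℓ : ℕ) : ℕ :=
  ((fun γ : ClosedPath G => s(γ, γ.reverse)) '' primitiveGeodesics G ℓ).ncard

/-- The `r`-th term of the power series of the modified Bessel function `I_m` at `z`. -/
def besselITerm (m : ℕ) (z : ℝ) (r : ℕ) : ℝ := (z / 2) ^ (m + 2 * r) / (r ! * (m + r)!)

/-- The modified Bessel function of the first kind `I_m(z)`, of integer order `m ≥ 0`. -/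
def besselI (m : ℕ) (z : ℝ) : ℝ := ∑' r : ℕ, besselITerm m z r

/-- The summand of `F_ℓ(t)` for an index `k`. -/
def FTerm (ℓ : ℕ) (t : ℝ) (k : ℕ) : ℝ :=
  besselI (k * ℓ) (2 * √2 * t) / (2 : ℝ) ^ ((k : ℝ) * (ℓ : ℝ) / 2)

/-- `F_ℓ(t) = ∑_{k ≥ 1} I_{kℓ}(2√2 t) / 2^{kℓ/2}`. -/
def F (ℓ : ℕ) (t : ℝ) : ℝ := ∑' k : {k : ℕ // 1 ≤ k}, FTerm ℓ t k

/-- The integrand of `J(t)`. -/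
def JIntegrand (t s : ℝ) : ℝ := Real.exp (s * t) * (√(8 - s ^ 2) / (9 - s ^ 2))

/-- `J(t)`, the integral of `e^{st}` against the spectral density of the cubic tree. -/
def J (t : ℝ) : ℝ := 3 / (2 * Real.pi) * ∫ s in (-(2 * √2))..(2 * √2), JIntegrand t s

section Spectrum

variable [Fintype V] [DecidableEq V] (G : SimpleGraph V) [DecidableRel G.Adj]

/-- The eigenvalues of the adjacency matrix of `G`, listed with multiplicity. -/
def eigenvalue : V → ℝ := Matrix.IsHermitian.eigenvalues (G.isHermitian_adjMatrix ℝ)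

/-- `(1/n) ∑ e^{tλ_i}`. -/
def expAverage (t : ℝ) : ℝ :=
  1 / (Fintype.card V : ℝ) * ∑ i : V, Real.exp (t * eigenvalue G i)

/-- The mean `μ` of the numbers `e^{λ_i/3}`. -/
def mean : ℝ := 1 / (Fintype.card V : ℝ) * ∑ i : V, Real.exp (eigenvalue G i / 3)

/-- The variance `σ` of the numbers `e^{λ_i/3}` (with the normalization `1/n`). -/
def variance : ℝ :=
  1 / (Fintype.card V : ℝ) * ∑ i : V, (Real.exp (eigenvalue G i / 3) - mean G) ^ 2

end Spectrum

end CubicTrace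

end

namespace CubicTrace

/-! ### Modified Bessel functions and their generating function -/

/-! The exponential is expanded in polynomials whose traces count closed geodesics. Put λ = α + 2/α,
z = α/√2 and x = 2√2 t. The Bessel generating function becomes e^{tλ} = I_0(x) + ∑_{m≥1} 2^{-m/2}
I_m(x) D_m(λ), where D_m is the Dickson polynomial with D_m(α + 2/α) = α^m + (2/α)^m
(`hasSum_besselI_dickson`).

Summing over the spectrum leaves the traces tr D_m(A). If B is the non-backtracking matrix on darts,
a trace form of the Ihara–Bass identity gives tr B^m = tr D_m(A) + n·[m even]
(`trace_nonbacktracking_pow`), and tr B^m is the number N_m of non-backtracking sequences of period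
m (`card_periodicNonbacktracking`). The even corrections combine with n·I_0 into n·J(t), because J =
I_0 − ∑_{j≥1} 2^{-j} I_{2j} (`hasSum_besselI_even`); this is the Fourier expansion of the spectral
density of the cubic tree.

Geometrically, closed geodesics are the closed walks of positive length that never backtrack, not
even at the closing point (`isClosedGeodesic_iff`). That such a walk is shortest in its class is
detected by its conjugacy class in a free group on edges. Primitive means that the length is the
minimal period, and no geodesic equals its reverse (`reverse_ne_of_isClosedGeodesic`), so N_m =
∑_{l∣m} 2 l m_l. Regrouping m = kl, by absolute convergence, yields ∑ 2 l m_l F_l(t). -/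

theorem abs_besselITerm (m : ℕ) (z : ℝ) (r : ℕ) :
    |besselITerm m z r| = besselITerm m |z| r := by
  unfold besselITerm
  rw [abs_div, abs_pow, abs_div, abs_two]
  congr 1
  exact abs_of_pos (by positivity)

/-- The pairs `(a, b)` of naturals, split according to whether `b ≤ a`, and recorded by the
difference and the minimum. -/
def differenceMinEquiv : (ℕ × ℕ) ⊕ (ℕ × ℕ) ≃ ℕ × ℕ where
  toFun := Sum.elim (fun p => (p.1 + p.2, p.2)) (fun p => (p.2, p.1 + 1 + p.2))
  invFun p := if p.2 ≤ p.1 then Sum.inl (p.1 - p.2, p.2) else Sum.inr (p.2 - p.1 - 1, p.1)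
  left_inv := by
    rintro (⟨a, b⟩ | ⟨a, b⟩)
    · simp
    · have : ¬ (a + 1 + b ≤ b) := by omega
      simp [this]
  right_inv := by
    rintro ⟨a, b⟩
    by_cases h : b ≤ a
    · simp [h]
    · simp [h]; omega

/-- The terms of the product of the exponential series of `x z / 2` and `x z⁻¹ / 2`. -/
noncomputable def expProductTerm (x : ℝ) (z : ℂ) (p : ℕ × ℕ) : ℂ :=
  ((x / 2 : ℂ) * z) ^ p.1 / p.1 ! * (((x / 2 : ℂ) * z⁻¹) ^ p.2 / p.2 !)

theorem hasSum_expProductTerm (x : ℝ) (z : ℂ) :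
    HasSum (expProductTerm x z) (Complex.exp ((x / 2 : ℂ) * (z + z⁻¹))) := by
  have h (w : ℂ) : HasSum (fun n : ℕ => w ^ n / (n ! : ℂ)) (Complex.exp w) := by
    rw [Complex.exp_eq_exp_ℂ]; exact NormedSpace.expSeries_div_hasSum_exp w
  have hn (w : ℂ) : Summable fun n : ℕ => ‖w ^ n / (n ! : ℂ)‖ :=
    NormedSpace.norm_expSeries_div_summable w
  rw [mul_add, Complex.exp_add]
  refine HasSum.mul (f := fun n : ℕ => ((x / 2 : ℂ) * z) ^ n / (n ! : ℂ))
    (g := fun n : ℕ => ((x / 2 : ℂ) * z⁻¹) ^ n / (n ! : ℂ)) (h _) (h _) ?_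
  exact summable_mul_of_summable_norm (f := fun n : ℕ => ((x / 2 : ℂ) * z) ^ n / (n ! : ℂ))
    (g := fun n : ℕ => ((x / 2 : ℂ) * z⁻¹) ^ n / (n ! : ℂ)) (hn _) (hn _)

theorem expProductTerm_inl (x : ℝ) {z : ℂ} (hz : z ≠ 0) (m r : ℕ) :
    expProductTerm x z (m + r, r) = (besselITerm m x r : ℝ) * z ^ m := by
  unfold expProductTerm besselITerm
  push_cast
  rw [mul_pow, mul_pow, pow_add z, inv_pow]
  field_simp
  ring

theorem expProductTerm_inr (x : ℝ) {z : ℂ} (hz : z ≠ 0) (m r : ℕ) :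
    expProductTerm x z (r, m + 1 + r) = (besselITerm (m + 1) x r : ℝ) * z⁻¹ ^ (m + 1) := by
  unfold expProductTerm besselITerm
  push_cast
  rw [mul_pow, mul_pow, pow_add z⁻¹ (m + 1) r, inv_pow z r]
  field_simp
  ring

theorem summable_besselITerm (m : ℕ) (x : ℝ) : Summable (besselITerm m x) := by
  have h := (hasSum_expProductTerm x 1).summable.comp_injective
    (i := fun r : ℕ => (m + r, r)) (fun a b h => by simpa using congrArg Prod.snd h)
  have h2 : (expProductTerm x 1 ∘ fun r : ℕ => (m + r, r)) =
      fun r => ((besselITerm m x r : ℝ) : ℂ) := by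
    funext r
    simp only [Function.comp]
    rw [expProductTerm_inl x one_ne_zero]
    simp
  rw [h2] at h
  exact Complex.summable_ofReal.mp h

theorem hasSum_besselI (m : ℕ) (x : ℝ) : HasSum (besselITerm m x) (besselI m x) :=
  (summable_besselITerm m x).hasSum

theorem abs_besselI_le (m : ℕ) (x : ℝ) : |besselI m x| ≤ besselI m |x| := by
  have h := norm_tsum_le_tsum_norm (summable_besselITerm m x).norm
  simp only [Real.norm_eq_abs, abs_besselITerm] at h
  exact h

/-- The generating function `exp (x (z + z⁻¹) / 2) = I₀(x) + ∑ I_m(x) (z ^ m + z⁻¹ ^ m)`. -/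
theorem hasSum_besselI_mul_pow_add (x : ℝ) {z : ℂ} (hz : z ≠ 0) :
    HasSum (fun m : ℕ => (besselI (m + 1) x : ℂ) * (z ^ (m + 1) + z⁻¹ ^ (m + 1)))
      (Complex.exp ((x / 2 : ℂ) * (z + z⁻¹)) - besselI 0 x) := by
  generalize hE : Complex.exp ((x / 2 : ℂ) * (z + z⁻¹)) = E
  have h : HasSum (expProductTerm x z ∘ differenceMinEquiv) E :=
    (differenceMinEquiv.hasSum_iff).mpr (hE ▸ hasSum_expProductTerm x z)
  have h1 : Summable fun p : ℕ × ℕ => expProductTerm x z (p.1 + p.2, p.2) :=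
    Summable.comp_injective (f := expProductTerm x z ∘ differenceMinEquiv) h.summable
      (i := Sum.inl) Sum.inl_injective
  have h2 : Summable fun p : ℕ × ℕ => expProductTerm x z (p.2, p.1 + 1 + p.2) :=
    Summable.comp_injective (f := expProductTerm x z ∘ differenceMinEquiv) h.summable
      (i := Sum.inr) Sum.inr_injective
  have e1 : HasSum (fun m : ℕ => (besselI m x : ℂ) * z ^ m)
      (∑' p : ℕ × ℕ, expProductTerm x z (p.1 + p.2, p.2)) := by
    refine h1.hasSum.prod_fiberwise fun m => ?_
    simp only [expProductTerm_inl x hz]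
    exact (Complex.hasSum_ofReal.mpr (hasSum_besselI m x)).mul_right _
  have e2 : HasSum (fun m : ℕ => (besselI (m + 1) x : ℂ) * z⁻¹ ^ (m + 1))
      (∑' p : ℕ × ℕ, expProductTerm x z (p.2, p.1 + 1 + p.2)) := by
    refine h2.hasSum.prod_fiberwise fun m => ?_
    simp only [expProductTerm_inr x hz]
    exact (Complex.hasSum_ofReal.mpr (hasSum_besselI (m + 1) x)).mul_right _
  have h3 := h.unique (HasSum.sum (f := expProductTerm x z ∘ differenceMinEquiv)
    h1.hasSum h2.hasSum)
  rw [h3]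
  -- Pairs with zero difference lie only in the first series; its term at m = 0 is the I_0 moved to
  -- the other side.
  have e3 := ((hasSum_nat_add_iff' 1).mpr e1).add e2
  simp only [Finset.sum_range_one, pow_zero, mul_one] at e3
  simp only [mul_add]
  rw [add_sub_right_comm]
  exact e3

/-- At |x| and z = y > 0 the generating series has nonnegative terms that dominate these. Since y is
arbitrary, I_m(x) decays faster than any geometric sequence, so it absorbs the exponential growth of
walk counts. -/
theorem summable_besselI_mul_pow (x : ℝ) {y : ℝ} (hy : 0 ≤ y) :
    Summable fun m : ℕ => |besselI m x| * y ^ m := by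
  rcases hy.eq_or_lt with rfl | hy
  · refine summable_of_ne_finset_zero (s := {0}) fun m hm => ?_
    simp at hm; simp [hm]
  have h := (hasSum_besselI_mul_pow_add |x| (z := (y : ℂ)) (by exact_mod_cast hy.ne')).summable
  have h' : Summable fun m : ℕ => besselI (m + 1) |x| * (y ^ (m + 1) + y⁻¹ ^ (m + 1)) := by
    refine Complex.summable_ofReal.mp (h.congr fun m => ?_)
    push_cast; rfl
  refine (summable_nat_add_iff 1).mp (h'.of_nonneg_of_le (fun m => by positivity) fun m => ?_)
  have := abs_besselI_le (m + 1) x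
  have h0 : 0 ≤ besselI (m + 1) |x| := (abs_nonneg _).trans this
  gcongr
  have : 0 ≤ y⁻¹ ^ (m + 1) := by positivity
  linarith

/-! ### The expansion of the exponential in Dickson polynomials -/

theorem aeval_dickson_add_two {R : Type*} [CommRing R] {A : Type*} [Ring A] [Algebra R A] (a : R)
    (x : A) (m : ℕ) :
    Polynomial.aeval x (Polynomial.dickson 1 a (m + 2)) =
      x * Polynomial.aeval x (Polynomial.dickson 1 a (m + 1)) -
        a • Polynomial.aeval x (Polynomial.dickson 1 a m) := by
  rw [Polynomial.dickson_add_two]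
  simp [Algebra.smul_def]

/-- Power sums of the roots of X² − (α + β)X + αβ obey the Dickson recurrence, with initial values 2
and α + β. -/
theorem eval_dickson_add {R : Type*} [CommRing R] (α β : R) (m : ℕ) :
    (Polynomial.dickson 1 (α * β) m).eval (α + β) = α ^ m + β ^ m := by
  induction m using Nat.twoStepInduction with
  | zero => simp; norm_num
  | one => simp
  | more m h1 h2 =>
    rw [Polynomial.dickson_add_two]
    simp only [Polynomial.eval_sub, Polynomial.eval_mul, Polynomial.eval_X, Polynomial.eval_C,
      h1, h2]
    ring

theorem eval_dickson_ofReal (a l : ℝ) (m : ℕ) :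
    (((Polynomial.dickson 1 a m).eval l : ℝ) : ℂ) =
      (Polynomial.dickson 1 (a : ℂ) m).eval (l : ℂ) := by
  have := Polynomial.map_dickson (k := 1) (a := a) Complex.ofRealHom m
  rw [show (a : ℂ) = Complex.ofRealHom a from rfl, ← this, Polynomial.eval_map,
    show (l : ℂ) = Complex.ofRealHom l from rfl, Polynomial.eval₂_at_apply]
  rfl

/-- The expansion of `exp (t l)` in the Dickson polynomials of parameter `2`. -/
theorem hasSum_besselI_dickson (t l : ℝ) :
    HasSum (fun m : ℕ => besselI (m + 1) (2 * √2 * t) / √2 ^ (m + 1) *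
      (Polynomial.dickson 1 (2 : ℝ) (m + 1)).eval l)
      (Real.exp (t * l) - besselI 0 (2 * √2 * t)) := by
  -- The root satisfies l = α + 2/α and is non-real when |l| < 2√2, hence the detour through ℂ. The
  -- generating function is used at z = α/√2, whose inverse is (2/α)/√2.
  obtain ⟨α, hα⟩ := IsAlgClosed.exists_root
    (Polynomial.X ^ 2 - Polynomial.C (l : ℂ) * Polynomial.X + 2 : Polynomial ℂ) (by
      have : (Polynomial.X ^ 2 - Polynomial.C (l : ℂ) * Polynomial.X + 2 : Polynomial ℂ).degree =
          2 := by
        rw [show (2 : Polynomial ℂ) = Polynomial.C 2 from rfl]; compute_degree!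
      rw [this]; norm_num)
  have hα : α ^ 2 - l * α + 2 = 0 := by simpa [Polynomial.IsRoot] using hα
  have hα0 : α ≠ 0 := by rintro rfl; simp at hα
  have hs : ((√2 : ℝ) : ℂ) ^ 2 = 2 := by norm_cast; simp
  have hs0 : ((√2 : ℝ) : ℂ) ≠ 0 := by norm_cast; positivity
  have hl : (l : ℂ) = α + 2 / α := by field_simp; linear_combination -hα
  have h := hasSum_besselI_mul_pow_add (2 * √2 * t) (div_ne_zero hα0 hs0)
  refine Complex.hasSum_ofReal.mp ?_
  convert h using 1
  · funext m
    rw [Complex.ofReal_mul, eval_dickson_ofReal, hl]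
    have := eval_dickson_add α (2 / α) (m + 1)
    rw [mul_div_cancel₀ _ hα0] at this
    rw [Complex.ofReal_ofNat, this]
    push_cast
    rw [show (α / ((√2 : ℝ) : ℂ))⁻¹ = (2 / α) / ((√2 : ℝ) : ℂ) by
      field_simp; exact hs, div_pow, div_pow _ ((√2 : ℝ) : ℂ)]
    ring
  · push_cast
    congr 2
    rw [hl]
    field_simp
    linear_combination -(t : ℂ) * hs

/-! ### The integral against the spectral density of the cubic tree -/

theorem hasSum_besselI_cos (x θ : ℝ) :
    HasSum (fun k : ℕ => besselI (k + 1) x * (2 * Real.cos ((k + 1 : ℕ) * θ)))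
      (Real.exp (x * Real.cos θ) - besselI 0 x) := by
  have h := hasSum_besselI_mul_pow_add x (Complex.exp_ne_zero (θ * Complex.I))
  refine Complex.hasSum_ofReal.mp ?_
  convert h using 1
  · funext k
    rw [← Complex.exp_neg, ← Complex.exp_nat_mul, ← Complex.exp_nat_mul]
    push_cast
    rw [Complex.two_cos]
    congr 3 <;> ring_nf
  · rw [← Complex.exp_neg, ← neg_mul, ← Complex.two_cos]
    push_cast
    congr 2
    ring

theorem integral_cos_int_mul (n : ℤ) :
    ∫ θ in (0 : ℝ)..Real.pi, Real.cos (n * θ) = if n = 0 then Real.pi else 0 := by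
  split_ifs with h
  · simp [h]
  · have h' : (n : ℝ) ≠ 0 := by exact_mod_cast h
    rw [intervalIntegral.integral_comp_mul_left (fun x => Real.cos x) h']
    simp [integral_cos, Real.sin_int_mul_pi]

theorem integral_cos_mul_cos (k m : ℕ) :
    ∫ θ in (0 : ℝ)..Real.pi, 2 * Real.cos (k * θ) * Real.cos (m * θ) =
      (if (k + m : ℤ) = 0 then Real.pi else 0) + (if (k - m : ℤ) = 0 then Real.pi else 0) := by
  rw [← integral_cos_int_mul, ← integral_cos_int_mul,
    ← intervalIntegral.integral_add (by apply Continuous.intervalIntegrable; fun_prop)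
      (by apply Continuous.intervalIntegrable; fun_prop)]
  refine intervalIntegral.integral_congr fun θ _ => ?_
  push_cast
  rw [Real.two_mul_cos_mul_cos, ← sub_mul, ← add_mul, add_comm]

/-- The Bessel values are the Fourier cosine coefficients of e^{x cos θ}: integrate the generating
function on the unit circle term by term and use orthogonality. For m = 0 only the subtracted
constant I_0 survives. -/
theorem integral_exp_mul_cos (x : ℝ) (m : ℕ) :
    ∫ θ in (0 : ℝ)..Real.pi, Real.exp (x * Real.cos θ) * Real.cos (m * θ) =
      Real.pi * besselI m x := by
  have hs : Summable fun k : ℕ => |besselI (k + 1) x| * 2 := by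
    have := (summable_nat_add_iff 1).mpr (summable_besselI_mul_pow x zero_le_one)
    simpa using this.mul_right 2
  have h := intervalIntegral.hasSum_integral_of_dominated_convergence
    (μ := MeasureTheory.volume) (a := 0) (b := Real.pi)
    (F := fun (k : ℕ) (θ : ℝ) =>
      besselI (k + 1) x * (2 * Real.cos ((k + 1 : ℕ) * θ) * Real.cos (m * θ)))
    (f := fun θ => (Real.exp (x * Real.cos θ) - besselI 0 x) * Real.cos (m * θ))
    (fun k _ => |besselI (k + 1) x| * 2)
    (fun k => by apply Continuous.aestronglyMeasurable; fun_prop)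
    (fun k => Filter.Eventually.of_forall fun θ _ => by
      rw [Real.norm_eq_abs, abs_mul, abs_mul, abs_mul, abs_two]
      gcongr
      nlinarith [Real.abs_cos_le_one ((k + 1 : ℕ) * θ), Real.abs_cos_le_one (m * θ),
        abs_nonneg (Real.cos ((k + 1 : ℕ) * θ)), abs_nonneg (Real.cos (m * θ))])
    (Filter.Eventually.of_forall fun _ _ => hs)
    (by simp)
    (Filter.Eventually.of_forall fun θ _ => by
      simpa only [mul_assoc] using (hasSum_besselI_cos x θ).mul_right (Real.cos (m * θ)))
  simp only [intervalIntegral.integral_const_mul, integral_cos_mul_cos] at h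
  have hI : ∫ θ in (0 : ℝ)..Real.pi, (Real.exp (x * Real.cos θ) - besselI 0 x) * Real.cos (m * θ) =
      (∫ θ in (0 : ℝ)..Real.pi, Real.exp (x * Real.cos θ) * Real.cos (m * θ)) -
        besselI 0 x * (if (m : ℤ) = 0 then Real.pi else 0) := by
    rw [← integral_cos_int_mul, ← intervalIntegral.integral_const_mul,
      ← intervalIntegral.integral_sub (by apply Continuous.intervalIntegrable; fun_prop)
      (by apply Continuous.intervalIntegrable; fun_prop)]
    refine intervalIntegral.integral_congr fun θ _ => ?_
    push_cast
    ring
  rw [hI] at h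
  rcases m with _ | m
  · have h1 (k : ℕ) : ¬ ((k + 1 : ℕ) : ℤ) = 0 := by push_cast; omega
    simp only [Nat.cast_zero, add_zero, sub_zero, h1, if_false, if_true, mul_zero] at h ⊢
    have h0 := h.unique hasSum_zero
    linarith
  · have h0 := h.unique (hasSum_single m fun k hk => by
      have h1 : ((k + 1 : ℕ) - (m + 1 : ℕ) : ℤ) ≠ 0 := by push_cast; omega
      have h2 : ((k + 1 : ℕ) + (m + 1 : ℕ) : ℤ) ≠ 0 := by push_cast; omega
      simp only [h1, h2, if_false]; ring)
    have h2 : ((m + 1 : ℕ) + (m + 1 : ℕ) : ℤ) ≠ 0 := by push_cast; omega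
    have h3 : ((m + 1 : ℕ) : ℤ) ≠ 0 := by push_cast; omega
    simp only [h2, h3, if_false, sub_self, if_true] at h0
    linarith

/-- Real part of the geometric series w/(1 − w) with w = e^{2iθ}/2. It is the cosine expansion of
the tree density in the angle given by s = 2√2 cos θ. -/
theorem hasSum_half_pow_mul_cos (θ : ℝ) :
    HasSum (fun j : ℕ => (1 / 2 : ℝ) ^ (j + 1) * Real.cos ((2 * (j + 1) : ℕ) * θ))
      (1 - 12 * Real.sin θ ^ 2 / (9 - 8 * Real.cos θ ^ 2)) := by
  set w : ℂ := Complex.exp ((2 * θ : ℝ) * Complex.I) / 2 with hw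
  have hn : ‖w‖ < 1 := by
    rw [hw, norm_div, Complex.norm_exp_ofReal_mul_I]; norm_num
  have h := ((hasSum_geometric_of_norm_lt_one hn).mul_left w)
  have h' := Complex.hasSum_re h
  convert h' using 1
  · funext j
    rw [← pow_succ', hw, div_pow (Complex.exp _), ← Complex.exp_nat_mul]
    rw [show ((j + 1 : ℕ) : ℂ) * ((2 * θ : ℝ) * Complex.I) =
      ((((2 * (j + 1) : ℕ) : ℝ) * θ : ℝ) : ℂ) * Complex.I by push_cast; ring]
    rw [show (2 : ℂ) ^ (j + 1) = ((2 ^ (j + 1) : ℝ) : ℂ) by push_cast; rfl, Complex.div_ofReal_re,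
      Complex.exp_ofReal_mul_I_re]
    rw [one_div, inv_pow]; ring
  · have hwre : w.re = Real.cos (2 * θ) / 2 := by
      rw [hw, show (2 : ℂ) = ((2 : ℝ) : ℂ) by norm_num, Complex.div_ofReal_re,
        Complex.exp_ofReal_mul_I_re]
    have hwim : w.im = Real.sin (2 * θ) / 2 := by
      rw [hw, show (2 : ℂ) = ((2 : ℝ) : ℂ) by norm_num, Complex.div_ofReal_im,
        Complex.exp_ofReal_mul_I_im]
    rw [Complex.mul_re, Complex.inv_re, Complex.inv_im, Complex.normSq_apply]
    simp only [Complex.sub_re, Complex.sub_im, Complex.one_re, Complex.one_im, hwre, hwim]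
    have h1 := Real.sin_sq_add_cos_sq (2 * θ)
    have h2 := Real.sin_sq_add_cos_sq θ
    have h3 := Real.cos_two_mul θ
    have hd : 9 - 8 * Real.cos θ ^ 2 ≠ 0 := by nlinarith [Real.cos_sq_le_one θ]
    have hden : (1 - Real.cos (2 * θ) / 2) * (1 - Real.cos (2 * θ) / 2) +
        (0 - Real.sin (2 * θ) / 2) * (0 - Real.sin (2 * θ) / 2) =
        (9 - 8 * Real.cos θ ^ 2) / 4 := by
      rw [h3] at h1 ⊢; nlinarith
    rw [hden]
    field_simp
    rw [h3] at h1 ⊢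
    have h4 : Real.sin θ ^ 2 = 1 - Real.cos θ ^ 2 := by linarith
    have h5 : Real.sin (2 * θ) ^ 2 = 1 - (2 * Real.cos θ ^ 2 - 1) ^ 2 := by linarith
    rw [h4]
    ring_nf
    ring_nf at h5
    rw [h5]
    ring

theorem continuousOn_JIntegrand (t : ℝ) :
    ContinuousOn (JIntegrand t) (Set.Icc (-(2 * √2)) (2 * √2)) := by
  unfold JIntegrand
  refine ContinuousOn.mul (by fun_prop) (ContinuousOn.div (by fun_prop) (by fun_prop) ?_)
  intro s hs
  have h2 : √2 ^ 2 = (2 : ℝ) := Real.sq_sqrt zero_le_two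
  have : s ^ 2 ≤ 8 := by nlinarith [hs.1, hs.2, Real.sqrt_nonneg 2]
  linarith

theorem intervalIntegrable_JIntegrand (t : ℝ) :
    IntervalIntegrable (JIntegrand t) MeasureTheory.volume (-(2 * √2)) (2 * √2) := by
  refine ContinuousOn.intervalIntegrable ?_
  rw [Set.uIcc_of_le (by linarith [Real.sqrt_nonneg 2])]
  exact continuousOn_JIntegrand t

theorem J_eq_integral (t : ℝ) :
    J t = 1 / Real.pi * ∫ θ in (0 : ℝ)..Real.pi, Real.exp (2 * √2 * t * Real.cos θ) *
      (12 * Real.sin θ ^ 2 / (9 - 8 * Real.cos θ ^ 2)) := by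
  have h2 : √2 ^ 2 = (2 : ℝ) := Real.sq_sqrt zero_le_two
  -- The limits are π and 0 in this order because cosine decreases; swapping them later cancels the
  -- sign of −sin θ.
  have h := intervalIntegral.integral_comp_mul_deriv'' (a := Real.pi) (b := 0)
    (f := fun θ => 2 * √2 * Real.cos θ) (f' := fun θ => 2 * √2 * -Real.sin θ)
    (g := JIntegrand t) (by fun_prop)
    (fun θ _ => ((Real.hasDerivAt_cos θ).const_mul _).hasDerivWithinAt) (by fun_prop)
    ((continuousOn_JIntegrand t).mono (by
      rintro _ ⟨θ, -, rfl⟩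
      constructor <;> nlinarith [Real.neg_one_le_cos θ, Real.cos_le_one θ, Real.sqrt_nonneg 2]))
  simp only [Real.cos_pi, Real.cos_zero, mul_neg, mul_one] at h
  unfold J
  rw [← h, intervalIntegral.integral_symm, ← intervalIntegral.integral_neg,
    ← intervalIntegral.integral_const_mul, ← intervalIntegral.integral_const_mul]
  refine intervalIntegral.integral_congr fun θ hθ => ?_
  rw [Set.uIcc_of_le Real.pi_pos.le] at hθ
  have hsin : 0 ≤ Real.sin θ := Real.sin_nonneg_of_mem_Icc hθ
  have h8 : 8 - (2 * √2 * Real.cos θ) ^ 2 = (2 * √2 * Real.sin θ) ^ 2 := by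
    rw [mul_pow, mul_pow, mul_pow, mul_pow, h2]
    linarith [Real.sin_sq_add_cos_sq θ]
  have h9 : 9 - (2 * √2 * Real.cos θ) ^ 2 = 9 - 8 * Real.cos θ ^ 2 := by
    rw [mul_pow, mul_pow, h2]; ring
  simp only [JIntegrand, Function.comp]
  rw [h8, h9, Real.sqrt_sq (by positivity)]
  rw [show 2 * √2 * Real.cos θ * t = 2 * √2 * t * Real.cos θ by ring]
  have : 2 * √2 * Real.sin θ * (2 * √2 * Real.sin θ) = 8 * Real.sin θ ^ 2 := by
    linear_combination 4 * Real.sin θ ^ 2 * h2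
  linear_combination (3 / (2 * Real.pi) * Real.exp (2 * √2 * t * Real.cos θ) /
    (9 - 8 * Real.cos θ ^ 2)) * this

/-- The Bessel expansion of `J`. -/
theorem hasSum_besselI_even (t : ℝ) :
    HasSum (fun j : ℕ => besselI (2 * (j + 1)) (2 * √2 * t) / 2 ^ (j + 1))
      (besselI 0 (2 * √2 * t) - J t) := by
  set x := 2 * √2 * t with hx
  have hs : Summable fun k : ℕ => Real.exp |x| * (1 / 2 : ℝ) ^ (k + 1) :=
    ((summable_nat_add_iff 1).mpr summable_geometric_two).mul_left _
  -- The cosine series of the density is multiplied by e^{x cos θ} and integrated term by term,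
  -- under a geometric majorant.
  have h := intervalIntegral.hasSum_integral_of_dominated_convergence
    (μ := MeasureTheory.volume) (a := 0) (b := Real.pi)
    (F := fun (j : ℕ) (θ : ℝ) =>
      (1 / 2 : ℝ) ^ (j + 1) * (Real.exp (x * Real.cos θ) * Real.cos ((2 * (j + 1) : ℕ) * θ)))
    (f := fun θ => Real.exp (x * Real.cos θ) *
      (1 - 12 * Real.sin θ ^ 2 / (9 - 8 * Real.cos θ ^ 2)))
    (fun k _ => Real.exp |x| * (1 / 2 : ℝ) ^ (k + 1))
    (fun k => by apply Continuous.aestronglyMeasurable; fun_prop)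
    (fun k => Filter.Eventually.of_forall fun θ _ => by
      rw [Real.norm_eq_abs, abs_mul, abs_mul, Real.abs_exp, mul_comm (Real.exp |x|),
        abs_of_nonneg (by positivity : (0 : ℝ) ≤ (1 / 2) ^ (k + 1))]
      gcongr
      refine (mul_le_of_le_one_right (Real.exp_pos _).le (Real.abs_cos_le_one _)).trans ?_
      rw [Real.exp_le_exp]
      refine (le_abs_self _).trans ?_
      rw [abs_mul]
      exact mul_le_of_le_one_right (abs_nonneg _) (Real.abs_cos_le_one _))
    (Filter.Eventually.of_forall fun _ _ => hs)
    (by simp)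
    (Filter.Eventually.of_forall fun θ _ => by
      simpa only [mul_left_comm] using
        (hasSum_half_pow_mul_cos θ).mul_left (Real.exp (x * Real.cos θ)))
  simp only [intervalIntegral.integral_const_mul, integral_exp_mul_cos] at h
  have hd (θ : ℝ) : 9 - 8 * Real.cos θ ^ 2 ≠ 0 := by nlinarith [Real.cos_sq_le_one θ]
  have h0 := integral_exp_mul_cos x 0
  simp only [Nat.cast_zero, zero_mul, Real.cos_zero, mul_one] at h0
  have hI : ∫ θ in (0 : ℝ)..Real.pi, Real.exp (x * Real.cos θ) *
      (1 - 12 * Real.sin θ ^ 2 / (9 - 8 * Real.cos θ ^ 2)) = Real.pi * (besselI 0 x - J t) := by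
    rw [J_eq_integral, mul_sub, ← h0, ← mul_assoc, mul_one_div_cancel Real.pi_ne_zero, one_mul,
      ← intervalIntegral.integral_sub (by apply Continuous.intervalIntegrable; fun_prop)
      (by
        apply Continuous.intervalIntegrable
        exact Continuous.mul (by fun_prop) (Continuous.div (by fun_prop) (by fun_prop) hd))]
    refine intervalIntegral.integral_congr fun θ _ => ?_
    ring
  rw [hI] at h
  have h' := h.mul_left (Real.pi)⁻¹
  rw [inv_mul_cancel_left₀ Real.pi_ne_zero] at h'
  refine h'.congr_fun fun j => ?_
  rw [one_div, inv_pow]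
  field_simp

/-! ### Traces of powers of the non-backtracking matrix -/

theorem aeval_dickson_zero {R : Type*} [CommRing R] {A : Type*} [Ring A] [Algebra R A] (a : R)
    (x : A) : Polynomial.aeval x (Polynomial.dickson 1 a 0) = (2 : R) • 1 := by
  rw [Polynomial.dickson_zero, map_sub, map_ofNat, Nat.cast_one, map_one, two_smul,
    one_add_one_eq_two]
  norm_num

section NonbacktrackingAlgebra

open Matrix

variable {V D : Type*} [Fintype V] [Fintype D] [DecidableEq D]
  {S : Matrix V D ℝ} {T : Matrix D V ℝ} {J : Matrix D D ℝ}

/-- In the application S and T are the start and end incidences of darts and J is the reversal of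
darts, not the integral `CubicTrace.J`. Then ST is the adjacency matrix A, B = TS − J is the
non-backtracking matrix, and SJT = 3 expresses cubicity. Expanding gives BJB = 3TS − TS − TS + J = B
+ 2J. -/
theorem mul_involution_mul_of_bass [DecidableEq V] (hJ : J * J = 1) (hSJT : S * J * T = 3) :
    (T * S - J) * J * (T * S - J) = (T * S - J) + (J + J) := by
  have h1 : T * S * J * (T * S) = (3 : ℝ) • (T * S) := by
    calc T * S * J * (T * S) = T * (S * J * T) * S := by simp only [Matrix.mul_assoc]
      _ = (3 : ℝ) • (T * S) := by
        rw [hSJT, show (3 : Matrix V V ℝ) = (3 : ℝ) • 1 by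
          rw [Matrix.smul_one_eq_diagonal]; rfl]
        simp
  have h2 : T * S * J * J = T * S := by rw [Matrix.mul_assoc, hJ, Matrix.mul_one]
  rw [sub_mul, sub_mul, mul_sub, mul_sub, h1, h2, hJ, one_mul, one_mul]
  module

/-- Cyclicity of the trace brings a factor BJB together. The traces tr(B^k J) are the error terms to
be eliminated. -/
theorem trace_pow_mul_involution_of_bass [DecidableEq V] (hJ : J * J = 1)
    (hSJT : S * J * T = 3) (k : ℕ) :
    trace ((T * S - J) ^ (k + 2) * J) =
      trace ((T * S - J) ^ (k + 1)) + 2 * trace ((T * S - J) ^ k * J) := by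
  have h := mul_involution_mul_of_bass hJ hSJT
  set B := T * S - J
  calc trace (B ^ (k + 2) * J) = trace (B * (B ^ k * (B * J))) := by
        rw [pow_succ, pow_succ']; simp only [Matrix.mul_assoc]
    _ = trace (B ^ k * (B * J * B)) := by rw [trace_mul_comm]; simp only [Matrix.mul_assoc]
    _ = trace (B ^ (k + 1) + (2 : ℝ) • (B ^ k * J)) := by
        rw [h]; congr 1
        rw [mul_add, pow_succ, mul_add, two_smul]
    _ = _ := by rw [trace_add, trace_smul, smul_eq_mul]

theorem trace_mul_pow_mul_of_bass (k : ℕ) :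
    trace (S * (T * S - J) ^ k * T) =
      trace ((T * S - J) ^ (k + 1)) + trace ((T * S - J) ^ k * J) := by
  rw [Matrix.mul_assoc, trace_mul_comm, Matrix.mul_assoc, ← trace_add, pow_succ, ← mul_add,
    sub_add_cancel]

/-- The matrix S B^k T counts non-backtracking walks of length k + 1. Prolonging one by a first step
either keeps it non-backtracking or cancels a step, the latter with weight 2 because SJB = 3S − S =
2S. -/
theorem mul_mul_pow_mul_of_bass [DecidableEq V] (hJ : J * J = 1)
    (hSJT : S * J * T = 3) (k : ℕ) :
    (S * T) * (S * (T * S - J) ^ (k + 1) * T) =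
      S * (T * S - J) ^ (k + 2) * T + (2 : ℝ) • (S * (T * S - J) ^ k * T) := by
  have h : S * J * (T * S - J) = (2 : ℝ) • S := by
    rw [Matrix.mul_sub, ← Matrix.mul_assoc, hSJT, Matrix.mul_assoc S J J, hJ, Matrix.mul_one,
      show (3 : Matrix V V ℝ) = (3 : ℝ) • 1 by rw [Matrix.smul_one_eq_diagonal]; rfl,
      Matrix.smul_mul, Matrix.one_mul]
    module
  have h2 : T * S = (T * S - J) + J := (sub_add_cancel _ _).symm
  generalize hB : T * S - J = B at *
  calc (S * T) * (S * B ^ (k + 1) * T) = S * (T * S) * B ^ (k + 1) * T := by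
        simp only [Matrix.mul_assoc]
    _ = S * B ^ (k + 2) * T + S * J * B * B ^ k * T := by
        rw [h2, Matrix.mul_add, Matrix.add_mul, Matrix.add_mul, Matrix.mul_assoc S B,
          ← pow_succ', pow_succ' B k]
        simp only [Matrix.mul_assoc]
    _ = _ := by rw [h]; simp

/-- Both sides satisfy x_{k+2} = A x_{k+1} − 2 x_k, so agreement at k = 0, 1 suffices. This
combination is chosen because its trace is free of tr(B^k J). -/
theorem mul_pow_mul_sub_eq_dickson_sub [DecidableEq V] (hJ : J * J = 1)
    (hSJT : S * J * T = 3) (k : ℕ) :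
    S * (T * S - J) ^ (k + 2) * T - (2 : ℝ) • (S * (T * S - J) ^ k * T) =
      Polynomial.aeval (S * T) (Polynomial.dickson 1 (2 : ℝ) (k + 3)) -
        Polynomial.aeval (S * T) (Polynomial.dickson 1 (2 : ℝ) (k + 1)) := by
  have h0 : S * (T * S - J) ^ 0 * T = S * T := by simp
  have h1 : S * (T * S - J) ^ 1 * T = S * T * (S * T) - (3 : ℝ) • 1 := by
    rw [pow_one, Matrix.mul_sub, Matrix.sub_mul, hSJT, Matrix.smul_one_eq_diagonal]
    simp only [Matrix.mul_assoc]; rfl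
  have hr := mul_mul_pow_mul_of_bass hJ hSJT
  generalize ha : (fun k => S * (T * S - J) ^ k * T) = a
  have ha' (k) : S * (T * S - J) ^ k * T = a k := congrFun ha k
  simp only [ha'] at *
  set A := S * T
  have hq := aeval_dickson_add_two (2 : ℝ) A
  have q0 := aeval_dickson_zero (2 : ℝ) A
  have q1 : Polynomial.aeval A (Polynomial.dickson 1 (2 : ℝ) 1) = A := by simp
  have hr' (k) : a (k + 2) = A * a (k + 1) - (2 : ℝ) • a k := by rw [hr]; abel
  induction k using Nat.twoStepInduction with
  | zero =>
    rw [hr', h1, h0, hq, hq, q0, q1]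
    simp only [mul_sub, Matrix.mul_smul, mul_one]
    module
  | one =>
    rw [hr', hr', h1, h0, hq, hq, hq, q0, q1]
    simp only [mul_sub, Matrix.mul_smul, mul_one]
    module
  | more k e1 e2 =>
    have := congrArg (A * ·) e2
    simp only [mul_sub, Matrix.mul_smul] at this
    calc a (k + 4) - (2 : ℝ) • a (k + 2)
        = (A * a (k + 3) - (2 : ℝ) • (A * a (k + 1))) -
            (2 : ℝ) • (a (k + 2) - (2 : ℝ) • a k) := by
          rw [hr' (k + 2), hr' k]; module
      _ = _ := by
          rw [this, e1, hq (k + 3), hq (k + 1)]; module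

/-- The previous identity shows that tr B^m − tr D_m(A) depends only on the parity of m. It is 0 at
m = 1; at m = 2 it is n, since tr B² = 0 and tr(A² − 4) = 3n − 4n. -/
theorem trace_nonbacktracking_pow [DecidableEq V] (hJ : J * J = 1) (hSJT : S * J * T = 3)
    (tJ : trace J = 0) (tA : trace (S * T) = 0)
    (tA2 : trace (S * T * (S * T)) = 3 * Fintype.card V)
    (hD : (Fintype.card D : ℝ) = 3 * Fintype.card V) (m : ℕ) :
    trace ((T * S - J) ^ (m + 1)) =
      trace (Polynomial.aeval (S * T) (Polynomial.dickson 1 (2 : ℝ) (m + 1))) +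
        if Even (m + 1) then (Fintype.card V : ℝ) else 0 := by
  have t3 : trace (3 : Matrix V V ℝ) = 3 * Fintype.card V := by
    rw [show (3 : Matrix V V ℝ) = (3 : ℝ) • 1 by rw [Matrix.smul_one_eq_diagonal]; rfl]
    simp
  induction m using Nat.twoStepInduction with
  | zero => simp [tJ, tA, trace_mul_comm T S]
  | one =>
    have h1 := trace_mul_pow_mul_of_bass (S := S) (T := T) (J := J) 1
    have h2 : trace (S * (T * S - J) ^ 1 * T) = 0 := by
      rw [pow_one, Matrix.mul_sub, Matrix.sub_mul, hSJT, trace_sub, t3, ← Matrix.mul_assoc,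
        Matrix.mul_assoc (S * T), tA2, sub_self]
    have h3 : trace ((T * S - J) ^ 1 * J) = 0 := by
      rw [pow_one, Matrix.sub_mul, hJ, trace_sub, Matrix.mul_assoc, trace_mul_comm, hSJT, t3,
        trace_one, hD, sub_self]
    rw [h2, h3, add_zero] at h1
    rw [← h1, aeval_dickson_add_two, aeval_dickson_zero, trace_sub, trace_smul]
    simp [tA2]
    ring
  | more k e1 e2 =>
    have h := congrArg trace (mul_pow_mul_sub_eq_dickson_sub hJ hSJT k)
    rw [trace_sub, trace_sub, trace_smul, trace_mul_pow_mul_of_bass, trace_mul_pow_mul_of_bass,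
      trace_pow_mul_involution_of_bass hJ hSJT, e1] at h
    have he : Even (k + 2 + 1) ↔ Even (k + 1) := by
      rw [show k + 2 + 1 = k + 1 + 2 by ring, Nat.even_add]; simp
    simp only [he]
    simp only [smul_eq_mul] at h
    rw [show k + 2 + 1 = k + 3 from rfl]
    linarith

end NonbacktrackingAlgebra

/-! ### Counting periodic sequences by traces -/

section PeriodicCount

open Matrix

variable {D : Type*} (R : D → D → Prop)

/-- The chains of length `m` from `d` to `e` for a relation `R`. -/
@[ext]
structure RelChain (m : ℕ) (d e : D) where
  /-- The elements of the chain. -/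
  elem : Fin (m + 1) → D
  elem_zero : elem 0 = d
  elem_last : elem (Fin.last m) = e
  step (i : Fin m) : R (elem i.castSucc) (elem i.succ)

instance [Finite D] (m : ℕ) (d e : D) : Finite (RelChain R m d e) :=
  Finite.of_injective RelChain.elem fun _ _ => RelChain.ext

variable {R} in
theorem RelChain.sigma_ext {ι : Type*} {a b : ι → D} {m : ℕ}
    {f g : Σ i : ι, RelChain R m (a i) (b i)} (h1 : f.1 = g.1) (h2 : f.2.elem = g.2.elem) :
    f = g := by
  obtain ⟨i, f⟩ := f
  obtain ⟨j, g⟩ := g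
  obtain rfl : i = j := h1
  exact congrArg _ (RelChain.ext h2)

/-- A chain of length `m + 1` consists of its first step and a chain of length `m`. -/
def relChainSuccEquiv (m : ℕ) (d e : D) :
    RelChain R (m + 1) d e ≃ Σ x : {x // R d x}, RelChain R m x e where
  toFun f := ⟨⟨f.elem 1, by simpa [f.elem_zero] using f.step 0⟩,
    ⟨Fin.tail f.elem, by simp [Fin.tail], by simpa [Fin.tail] using f.elem_last,
      fun i => by simpa [Fin.tail] using f.step i.succ⟩⟩
  invFun g := ⟨Fin.cons d g.2.elem, by simp, by
    rw [← Fin.succ_last, Fin.cons_succ]; exact g.2.elem_last, fun i => by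
      refine Fin.cases ?_ (fun j => ?_) i
      · simpa [g.2.elem_zero] using g.1.2
      · simpa using g.2.step j⟩
  left_inv f := by
    apply RelChain.ext
    funext i
    refine Fin.cases ?_ (fun j => ?_) i
    · simp [f.elem_zero]
    · simp [Fin.tail]
  right_inv g := by
    refine RelChain.sigma_ext (Subtype.ext ?_) ?_
    · change (Fin.cons d g.2.elem : Fin (m + 2) → D) (Fin.succ 0) = g.1.1
      rw [Fin.cons_succ, g.2.elem_zero]
    · simp

variable {R}

/-- The periodic sequences of a relation are its closed chains. -/
def periodicEquivRelChain {m : ℕ} (hm : 0 < m) :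
    {f : ℕ → D // (∀ i, R (f i) (f (i + 1))) ∧ Function.Periodic f m} ≃
      Σ d, RelChain R m d d where
  toFun f := ⟨f.1 0, ⟨fun i => f.1 i, rfl, by simpa using f.2.2 0, fun i => f.2.1 i⟩⟩
  invFun g := ⟨fun i => g.2.elem ⟨i % m, (Nat.mod_lt i hm).trans (Nat.lt_succ_self m)⟩, fun i => by
      have hlt := Nat.mod_lt i hm
      have h := g.2.step ⟨i % m, hlt⟩
      have e : g.2.elem ⟨(i + 1) % m, (Nat.mod_lt _ hm).trans (Nat.lt_succ_self m)⟩ =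
          g.2.elem (⟨i % m, hlt⟩ : Fin m).succ := by
        by_cases hi : i % m + 1 = m
        · have h0 : (i + 1) % m = 0 := by rw [← Nat.mod_add_mod, hi, Nat.mod_self]
          have e1 : (⟨(i + 1) % m, (Nat.mod_lt _ hm).trans (Nat.lt_succ_self m)⟩ : Fin (m + 1)) =
            0 := Fin.ext h0
          have e2 : (⟨i % m, hlt⟩ : Fin m).succ = Fin.last m := Fin.ext hi
          rw [e1, e2, g.2.elem_zero, g.2.elem_last]
        · congr 1
          apply Fin.ext
          simp only [Fin.val_succ]
          rw [← Nat.mod_add_mod, Nat.mod_eq_of_lt (by omega)]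
      rw [← e] at h
      exact h,
    fun i => by simp⟩
  left_inv f := Subtype.ext (funext fun i => f.2.2.map_mod_nat i)
  right_inv g := by
    refine RelChain.sigma_ext (a := id) (b := id) ?_ ?_
    · simp [g.2.elem_zero]
    · funext i
      by_cases hi : (i : ℕ) = m
      · have e2 : i = Fin.last m := Fin.ext hi
        subst e2
        simp [g.2.elem_zero, g.2.elem_last]
      · simp [Nat.mod_eq_of_lt (show (i : ℕ) < m by omega)]

variable [Fintype D] [DecidableEq D] [DecidableRel R] {B : Matrix D D ℝ}

theorem pow_apply_eq_card_relChain (hB : ∀ d e, B d e = if R d e then 1 else 0) (m : ℕ) (d e : D) :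
    (B ^ m) d e = Nat.card (RelChain R m d e) := by
  induction m generalizing d with
  | zero =>
    rw [pow_zero, Matrix.one_apply]
    split_ifs with h
    · subst h
      have : Unique (RelChain R 0 d d) :=
        { default := ⟨fun _ => d, rfl, rfl, fun i => i.elim0⟩
          uniq := fun f => RelChain.ext (funext fun i => by
            rw [Fin.fin_one_eq_zero i]; exact f.elem_zero) }
      simp
    · have : IsEmpty (RelChain R 0 d e) := ⟨fun f => h (f.elem_zero.symm.trans f.elem_last)⟩
      simp
  | succ m ih =>
    rw [Nat.card_congr (relChainSuccEquiv R m d e), Nat.card_sigma, pow_succ', Matrix.mul_apply]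
    push_cast
    rw [← Finset.sum_subtype (Finset.univ.filter (R d)) (by simp)
      (fun x => (Nat.card (RelChain R m x e) : ℝ)), Finset.sum_filter]
    refine Finset.sum_congr rfl fun x _ => ?_
    rw [hB, ih]
    split_ifs <;> simp

/-- Closed chains are recorded as periodic sequences on ℕ, so that rotations become iterates of the
shift and repetition is governed by minimal periods. -/
theorem trace_pow_eq_card_periodic (hB : ∀ d e, B d e = if R d e then 1 else 0) {m : ℕ}
    (hm : 0 < m) :
    trace (B ^ m) =
      Nat.card {f : ℕ → D // (∀ i, R (f i) (f (i + 1))) ∧ Function.Periodic f m} := by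
  rw [Nat.card_congr (periodicEquivRelChain hm), Nat.card_sigma, trace]
  push_cast
  exact Finset.sum_congr rfl fun d _ => pow_apply_eq_card_relChain hB m d d

end PeriodicCount

/-! ### The dart matrices of a cubic graph and its non-backtracking walks. -/

section Nonbacktracking

open Matrix

variable {V : Type*} (G : SimpleGraph V)

/-- An infinite walk that never turns back. -/
def IsNonbacktracking (c : ℕ → V) : Prop := ∀ i, G.Adj (c i) (c (i + 1)) ∧ c (i + 2) ≠ c i

/-- The non-backtracking infinite walks of period `m`. -/
def periodicNonbacktracking (m : ℕ) : Set (ℕ → V) :=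
  {c | IsNonbacktracking G c ∧ Function.Periodic c m}

/-- Non-backtracking walks as sequences of darts. -/
def periodicDartEquiv (m : ℕ) :
    periodicNonbacktracking G m ≃
      {f : ℕ → G.Dart // (∀ i, (f i).snd = (f (i + 1)).fst ∧ f (i + 1) ≠ (f i).symm) ∧
        Function.Periodic f m} where
  toFun c := ⟨fun i => ⟨(c.1 i, c.1 (i + 1)), (c.2.1 i).1⟩, fun i => ⟨rfl, fun h =>
    (c.2.1 i).2 (congrArg (fun d : G.Dart => d.snd) h)⟩, fun i => by
      apply SimpleGraph.Dart.ext
      simp only [add_right_comm i m 1, c.2.2 _]⟩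
  invFun f := ⟨fun i => (f.1 i).fst, fun i => ⟨by
      have h := (f.1 i).adj
      rwa [(f.2.1 i).1] at h,
    fun h => (f.2.1 i).2 (by
      apply SimpleGraph.Dart.ext
      apply Prod.ext
      · exact (f.2.1 i).1.symm
      · exact (f.2.1 (i + 1)).1.trans h)⟩, fun i => by simp only [f.2.2 i]⟩
  left_inv c := rfl
  right_inv f := Subtype.ext (funext fun i => by
    apply SimpleGraph.Dart.ext
    exact Prod.ext rfl (f.2.1 i).1.symm)

variable [Fintype V]

section Darts

variable [DecidableRel G.Adj]

theorem card_dart_eq (hG : G.IsRegularOfDegree 3) :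
    (Fintype.card G.Dart : ℝ) = 3 * Fintype.card V := by
  rw [G.dart_card_eq_sum_degrees]
  simp [hG.degree_eq, mul_comm]

theorem finite_periodicNonbacktracking {m : ℕ} (hm : 0 < m) :
    (periodicNonbacktracking G m).Finite := by
  have := Finite.of_equiv _ (periodicEquivRelChain
    (R := fun d e : G.Dart => d.snd = e.fst ∧ e ≠ d.symm) hm).symm
  exact Set.finite_coe_iff.mp (Finite.of_equiv _ (periodicDartEquiv G m).symm)

end Darts

variable [DecidableEq V]

/-- The incidence of vertices and the darts starting there. -/
def dartStart : Matrix V G.Dart ℝ := Matrix.of fun v d => if d.fst = v then 1 else 0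

/-- The incidence of darts and their end points. -/
def dartEnd : Matrix G.Dart V ℝ := Matrix.of fun d v => if d.snd = v then 1 else 0

/-- The permutation matrix of the reversal of darts. -/
def dartFlip : Matrix G.Dart G.Dart ℝ := Matrix.of fun d e => if e = d.symm then 1 else 0

theorem dartEnd_mul_dartStart_sub_dartFlip_apply (d e : G.Dart) :
    (dartEnd G * dartStart G - dartFlip G) d e =
      if d.snd = e.fst ∧ e ≠ d.symm then 1 else 0 := by
  have h : (dartEnd G * dartStart G) d e = if d.snd = e.fst then 1 else 0 := by
    simp [Matrix.mul_apply, dartStart, dartEnd, eq_comm]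
  rw [Matrix.sub_apply, h, dartFlip, Matrix.of_apply]
  by_cases he : e = d.symm
  · subst he; simp
  · simp [he]

variable [DecidableRel G.Adj]

theorem dartStart_mul_dartEnd : dartStart G * dartEnd G = G.adjMatrix ℝ := by
  ext u v
  rw [Matrix.mul_apply, SimpleGraph.adjMatrix_apply]
  simp only [dartStart, dartEnd, Matrix.of_apply, ite_mul, one_mul, zero_mul]
  split_ifs with h
  · rw [Finset.sum_eq_single ⟨(u, v), h⟩]
    · simp
    · intro d _ hd
      by_contra hne
      simp only [ite_eq_right_iff, not_forall] at hne
      obtain ⟨h1, h2, -⟩ := hne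
      exact hd (SimpleGraph.Dart.ext _ _ (Prod.ext h1 h2))
    · simp
  · refine Finset.sum_eq_zero fun d _ => ?_
    split_ifs with h1 h2
    · exact absurd (h1 ▸ h2 ▸ d.adj) h
    · rfl
    · rfl

theorem dartFlip_mul_apply {W : Type*} (M : Matrix G.Dart W ℝ) (d : G.Dart) (w : W) :
    (dartFlip G * M) d w = M d.symm w := by
  rw [Matrix.mul_apply, Finset.sum_eq_single d.symm]
  · simp [dartFlip]
  · intro e _ he
    simp [dartFlip, he]
  · simp

theorem dartFlip_mul_self : dartFlip G * dartFlip G = 1 := by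
  ext d e
  rw [dartFlip_mul_apply]
  simp [dartFlip, Matrix.one_apply, eq_comm]

/-- Going out along a dart and returning along its reverse gives the diagonal matrix of degrees. -/
theorem dartStart_mul_dartFlip_mul_dartEnd (hG : G.IsRegularOfDegree 3) :
    dartStart G * dartFlip G * dartEnd G = 3 := by
  have h : dartFlip G * dartEnd G = Matrix.of fun d v => if d.fst = v then 1 else 0 := by
    ext d v
    rw [dartFlip_mul_apply]
    simp [dartEnd]
  rw [Matrix.mul_assoc, h]
  ext u v
  rw [show (3 : Matrix V V ℝ) = Matrix.diagonal fun _ => 3 from rfl, Matrix.diagonal_apply,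
    Matrix.mul_apply]
  simp only [dartStart, Matrix.of_apply, ite_mul, one_mul, zero_mul]
  rw [← Finset.sum_filter]
  have hu := G.dart_fst_fiber_card_eq_degree u
  rw [hG u] at hu
  rw [Finset.sum_congr rfl (g := fun _ => if u = v then (1 : ℝ) else 0) (by
    intro d hd; rw [(Finset.mem_filter.mp hd).2]), Finset.sum_const]
  rw [hu]
  split_ifs <;> simp

/-- The number of closed non-backtracking walks in terms of the adjacency matrix. -/
theorem card_periodicNonbacktracking (hG : G.IsRegularOfDegree 3) (m : ℕ) :
    ((periodicNonbacktracking G (m + 1)).ncard : ℝ) =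
      trace (Polynomial.aeval (G.adjMatrix ℝ) (Polynomial.dickson 1 (2 : ℝ) (m + 1))) +
        if Even (m + 1) then (Fintype.card V : ℝ) else 0 := by
  have h := trace_nonbacktracking_pow (dartFlip_mul_self G)
    (dartStart_mul_dartFlip_mul_dartEnd G hG)
    (by
      rw [trace]
      exact Finset.sum_eq_zero fun d _ => by simp [dartFlip, d.symm_ne.symm])
    (by rw [dartStart_mul_dartEnd]; simp)
    (by
      rw [dartStart_mul_dartEnd, trace]
      simp only [Matrix.diag_apply, SimpleGraph.adjMatrix_mul_self_apply_self, hG.degree_eq]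
      simp [mul_comm])
    (card_dart_eq G hG) m
  rw [dartStart_mul_dartEnd] at h
  rw [← h, trace_pow_eq_card_periodic (dartEnd_mul_dartStart_sub_dartFlip_apply G) m.succ_pos,
    ← Nat.card_congr (periodicDartEquiv G (m + 1)), Nat.card_coe_set_eq]

/-- The trace of a polynomial in the adjacency matrix as a sum over the eigenvalues. -/
theorem trace_aeval_adjMatrix (p : Polynomial ℝ) :
    trace (Polynomial.aeval (G.adjMatrix ℝ) p) = ∑ i, p.eval (eigenvalue G i) := by
  have hA := G.isHermitian_adjMatrix ℝ
  conv_lhs => rw [hA.spectral_theorem]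
  rw [Polynomial.aeval_algHom_apply, Unitary.conjStarAlgAut_apply, trace_mul_comm, ← mul_assoc,
    Unitary.coe_star_mul_self, one_mul,
    ← Matrix.diagonalAlgHom_apply (R := ℝ), Polynomial.aeval_algHom_apply,
    Matrix.diagonalAlgHom_apply, trace_diagonal, Polynomial.aeval_pi_apply]
  rfl

end Nonbacktracking

/-! ### Closed walks as periodic sequences -/

section Sequences

variable {V : Type*} {G : SimpleGraph V}

/-- The shift on sequences. -/
def shift (c : ℕ → V) : ℕ → V := fun i => c (i + 1)

theorem shift_iterate_apply (s : ℕ) (c : ℕ → V) (i : ℕ) : shift^[s] c i = c (i + s) := by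
  induction s generalizing c with
  | zero => rfl
  | succ s ih =>
    rw [Function.iterate_succ_apply, ih]
    exact congrArg c (by ring)

theorem isPeriodicPt_shift_iff {c : ℕ → V} {m : ℕ} :
    Function.IsPeriodicPt shift m c ↔ Function.Periodic c m := by
  constructor
  · intro h i
    rw [← shift_iterate_apply m c i, h.eq]
  · intro h
    funext i
    rw [shift_iterate_apply, h i]

theorem shift_iterate_mod {c : ℕ → V} {m : ℕ} (h : Function.Periodic c m) (s : ℕ) :
    shift^[s % m] c = shift^[s] c :=
  (isPeriodicPt_shift_iff.mpr h).iterate_mod_apply s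

/-- If `d` is a shift of `c`, then `c` is a shift of `d`. -/
theorem exists_shift_symm {c d : ℕ → V} {m s : ℕ} (hm : 0 < m) (hc : Function.Periodic c m)
    (h : d = shift^[s] c) : ∃ t, c = shift^[t] d := by
  -- Together with s this makes the total shift s·m, a multiple of the period.
  refine ⟨s * m - s, ?_⟩
  rw [h, ← Function.iterate_add_apply, Nat.sub_add_cancel (Nat.le_mul_of_pos_right s hm),
    ← shift_iterate_mod hc, Nat.mul_mod_left]
  rfl

/-- The periodic sequence of vertices of a closed walk. -/
def closedSeq {v : V} (p : G.Walk v v) : ℕ → V := fun i => p.getVert (i % p.length)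

theorem periodic_closedSeq {v : V} (p : G.Walk v v) : Function.Periodic (closedSeq p) p.length :=
  fun i => by simp [closedSeq]

theorem closedSeq_of_le {v : V} (p : G.Walk v v) {i : ℕ} (hi : i ≤ p.length) :
    closedSeq p i = p.getVert i := by
  rcases hi.eq_or_lt with rfl | h
  · simp [closedSeq]
  · simp [closedSeq, Nat.mod_eq_of_lt h]

theorem closedSeq_zero {v : V} (p : G.Walk v v) : closedSeq p 0 = v := by
  simp [closedSeq]

/-- Here i % 0 = i, and `getVert` past the end returns the end point. -/
theorem closedSeq_of_length_eq_zero {v : V} (p : G.Walk v v) (h : p.length = 0) (i : ℕ) :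
    closedSeq p i = v := p.getVert_of_length_le (by omega)

theorem adj_closedSeq {v : V} (p : G.Walk v v) (hp : 0 < p.length) (i : ℕ) :
    G.Adj (closedSeq p i) (closedSeq p (i + 1)) := by
  have hi := Nat.mod_lt i hp
  have h := p.adj_getVert_succ hi
  rw [← closedSeq_of_le p hi] at h
  have e : closedSeq p (i % p.length + 1) = closedSeq p (i + 1) := by
    unfold closedSeq
    rw [Nat.mod_add_mod]
  rwa [e] at h

theorem closedSeq_append_comm {u v : V} (p : G.Walk u v) (q : G.Walk v u) :
    closedSeq (q.append p) = shift^[p.length] (closedSeq (p.append q)) := by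
  funext i
  rw [shift_iterate_apply]
  have hlen : (q.append p).length = (p.append q).length := by
    simp [SimpleGraph.Walk.length_append, add_comm]
  by_cases h0 : (p.append q).length = 0
  · rw [closedSeq_of_length_eq_zero _ (hlen.trans h0), closedSeq_of_length_eq_zero _ h0]
    refine (SimpleGraph.Walk.eq_of_length_eq_zero (p := p) ?_).symm
    rw [SimpleGraph.Walk.length_append] at h0
    omega
  · have hpos : 0 < (p.append q).length := Nat.pos_of_ne_zero h0
    have hq := (periodic_closedSeq (q.append p)).map_mod_nat i
    rw [hlen] at hq
    have hp := ((periodic_closedSeq (p.append q)).map_mod_nat (i + p.length))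
    rw [← Nat.mod_add_mod] at hp
    have hr := Nat.mod_lt i hpos
    have hp' := (periodic_closedSeq (p.append q)).map_mod_nat (i % (p.append q).length + p.length)
    rw [← hq, ← hp, hp']
    generalize i % (p.append q).length = r at hr
    rw [closedSeq_of_le _ (hlen ▸ hr.le)]
    have hl := SimpleGraph.Walk.length_append p q
    by_cases hrq : r < q.length
    · rw [closedSeq_of_le _ (by omega), SimpleGraph.Walk.getVert_append,
        SimpleGraph.Walk.getVert_append, if_pos hrq, if_neg (by omega)]
      congr 1
      omega
    · have e : closedSeq (p.append q) (r + p.length) = closedSeq (p.append q) (r - q.length) := by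
        rw [← (periodic_closedSeq (p.append q)) (r - q.length)]
        congr 1
        omega
      rw [e, closedSeq_of_le _ (by omega), SimpleGraph.Walk.getVert_append,
        SimpleGraph.Walk.getVert_append, if_neg hrq, if_pos (by omega)]

theorem sigma_eq_of_closedSeq_eq {v w : V} {p : G.Walk v v} {q : G.Walk w w}
    (hl : p.length = q.length) (h : closedSeq p = closedSeq q) :
    (⟨v, p⟩ : BasedClosedPath G) = ⟨w, q⟩ := by
  obtain rfl : v = w := by rw [← closedSeq_zero p, h, closedSeq_zero]
  rw [SimpleGraph.Walk.ext_getVert_le_length hl fun k hk => by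
    rw [← closedSeq_of_le p hk, h, closedSeq_of_le q (hl ▸ hk)]]

theorem exists_rotation {v : V} (p : G.Walk v v) (s : ℕ) :
    ∃ (w : V) (q : G.Walk w w), ClosedPath.ofWalk q = ClosedPath.ofWalk p ∧
      q.length = p.length ∧ closedSeq q = shift^[s] (closedSeq p) := by
  have hp := p.append_take_drop_eq (s % p.length)
  refine ⟨_, (p.drop (s % p.length)).append (p.take (s % p.length)), ?_, ?_, ?_⟩
  · conv_rhs => rw [← hp]
    exact (Quot.sound (IsRotation.mk _ _)).symm
  · conv_rhs => rw [← hp]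
    rw [SimpleGraph.Walk.length_append, SimpleGraph.Walk.length_append, add_comm]
  · rw [closedSeq_append_comm, hp, SimpleGraph.Walk.take_length]
    by_cases h0 : p.length = 0
    · funext i
      rw [shift_iterate_apply, shift_iterate_apply, closedSeq_of_length_eq_zero p h0,
        closedSeq_of_length_eq_zero p h0]
    · rw [min_eq_left (Nat.mod_lt _ (Nat.pos_of_ne_zero h0)).le,
        shift_iterate_mod (periodic_closedSeq p)]

/-- With `ofWalk_eq_of_shift`, this identifies closed paths with shift orbits together with a
length. The length is needed because the sequence does not see how often a closed walk is traversed.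
-/
theorem exists_shift_of_ofWalk_eq {v w : V} {p : G.Walk v v} {q : G.Walk w w}
    (h : ClosedPath.ofWalk p = ClosedPath.ofWalk q) :
    p.length = q.length ∧ ∃ s, closedSeq q = shift^[s] (closedSeq p) := by
  have hl : p.length = q.length := congrArg ClosedPath.length h
  refine ⟨hl, ?_⟩
  suffices H : ∀ a b : BasedClosedPath G, Relation.EqvGen (IsRotation G) a b →
      a.2.length = b.2.length ∧ ∃ s, closedSeq b.2 = shift^[s] (closedSeq a.2) from
    (H _ _ (Quot.eqvGen_exact h)).2
  intro a b hab
  induction hab with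
  | rel a b hab =>
    obtain ⟨p, q⟩ := hab
    exact ⟨by simp [SimpleGraph.Walk.length_append, add_comm], _, closedSeq_append_comm p q⟩
  | refl a => exact ⟨rfl, 0, rfl⟩
  | symm a b _ ih =>
    obtain ⟨hl, s, hs⟩ := ih
    refine ⟨hl.symm, ?_⟩
    -- Inverting a shift needs a positive period, so constant paths are treated separately.
    rcases Nat.eq_zero_or_pos a.2.length with h0 | h0
    · refine ⟨0, funext fun i => ?_⟩
      have := congrFun hs i
      rw [shift_iterate_apply, closedSeq_of_length_eq_zero a.2 h0] at this
      rw [closedSeq_of_length_eq_zero a.2 h0]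
      exact this.symm
    · exact exists_shift_symm h0 (periodic_closedSeq a.2) hs
  | trans a b c _ _ ih1 ih2 =>
    obtain ⟨hl1, s, hs⟩ := ih1
    obtain ⟨hl2, t, ht⟩ := ih2
    exact ⟨hl1.trans hl2, t + s, by rw [ht, hs, Function.iterate_add_apply]⟩

theorem ofWalk_eq_of_shift {v w : V} {p : G.Walk v v} {q : G.Walk w w}
    (hl : p.length = q.length) {s : ℕ} (h : closedSeq q = shift^[s] (closedSeq p)) :
    ClosedPath.ofWalk p = ClosedPath.ofWalk q := by
  obtain ⟨x, r, hr, hrl, hrs⟩ := exists_rotation p s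
  rw [← hr]
  exact congrArg (Quot.mk _) (sigma_eq_of_closedSeq_eq (hrl.trans hl) (hrs.trans h.symm))

theorem exists_walk_of_seq {c : ℕ → V} (hc : ∀ i, G.Adj (c i) (c (i + 1))) (m : ℕ) :
    ∃ p : G.Walk (c 0) (c m), p.length = m ∧ ∀ i ≤ m, p.getVert i = c i := by
  induction m with
  | zero => exact ⟨.nil, rfl, fun i hi => by simp [Nat.le_zero.mp hi]⟩
  | succ m ih =>
    obtain ⟨p, hl, hp⟩ := ih
    refine ⟨p.append (.cons (hc m) .nil), by simp [hl], fun i hi => ?_⟩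
    rw [SimpleGraph.Walk.getVert_append, hl]
    split_ifs with h
    · exact hp i h.le
    · rcases hi.eq_or_lt with rfl | hi
      · simp
      · obtain rfl : i = m := by omega
        simp

theorem exists_closedSeq_eq {c : ℕ → V} (hc : ∀ i, G.Adj (c i) (c (i + 1))) {m : ℕ}
    (hpos : 0 < m) (hm : Function.Periodic c m) :
    ∃ p : G.Walk (c 0) (c 0), p.length = m ∧ closedSeq p = c := by
  obtain ⟨p, hl, hp⟩ := exists_walk_of_seq hc m
  have h0 : c m = c 0 := by simpa using hm 0
  refine ⟨p.copy rfl h0, by simpa using hl, funext fun i => ?_⟩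
  simp only [closedSeq, SimpleGraph.Walk.length_copy, SimpleGraph.Walk.getVert_copy, hl]
  rw [hp _ (Nat.mod_lt i hpos).le, hm.map_mod_nat]

/-! ### Powers and reversals of closed walks -/

theorem length_walkPow {v : V} (p : G.Walk v v) (k : ℕ) :
    (ClosedPath.walkPow p k).length = k * p.length := by
  induction k with
  | zero => simp [ClosedPath.walkPow]
  | succ k ih => rw [ClosedPath.walkPow, SimpleGraph.Walk.length_append, ih]; ring

theorem getVert_walkPow {v : V} (p : G.Walk v v) (k : ℕ) {i : ℕ} (hi : i ≤ k * p.length) :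
    (ClosedPath.walkPow p k).getVert i = closedSeq p i := by
  induction k generalizing i with
  | zero =>
    rw [zero_mul, Nat.le_zero] at hi
    subst hi
    simp [closedSeq_zero]
  | succ k ih =>
    rw [ClosedPath.walkPow, SimpleGraph.Walk.getVert_append]
    split_ifs with h
    · exact (closedSeq_of_le p h.le).symm
    · rw [ih (by rw [add_mul, one_mul] at hi; omega)]
      conv_rhs => rw [← Nat.sub_add_cancel (not_lt.mp h)]
      exact ((periodic_closedSeq p) _).symm

theorem closedSeq_walkPow {v : V} (p : G.Walk v v) {k : ℕ} (hk : 0 < k) (hp : 0 < p.length) :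
    closedSeq (ClosedPath.walkPow p k) = closedSeq p := by
  funext i
  unfold closedSeq
  rw [getVert_walkPow, length_walkPow]
  · exact ((periodic_closedSeq p).nat_mul k).map_mod_nat i
  · rw [length_walkPow]
    exact (Nat.mod_lt _ (by positivity)).le

/-- The factor p.length − 1 represents −1 modulo the length and avoids truncated subtraction. -/
theorem closedSeq_reverse {v : V} (p : G.Walk v v) (hp : 0 < p.length) (i : ℕ) :
    closedSeq p.reverse i = closedSeq p ((p.length - 1) * i) := by
  have h1 : closedSeq p.reverse i = closedSeq p (p.length - i % p.length) := by
    rw [closedSeq_of_le p (Nat.sub_le _ _)]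
    simp [closedSeq, SimpleGraph.Walk.getVert_reverse]
  have hm : p.length - i % p.length ≡ (p.length - 1) * i [MOD p.length] := by
    refine Nat.ModEq.add_right_cancel' (i % p.length) ?_
    rw [Nat.sub_add_cancel (Nat.mod_lt i hp).le]
    refine Nat.ModEq.symm (((Nat.mod_modEq i p.length).add_left _).trans ?_)
    rw [← Nat.succ_mul, Nat.succ_eq_add_one, Nat.sub_add_cancel hp]
    simp [Nat.ModEq]
  rw [h1]
  unfold closedSeq
  rw [hm]

end Sequences

/-! ### Closed geodesics are the non-backtracking closed walks -/

section Holonomy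

variable {V : Type*} {G : SimpleGraph V} (e : V → ℕ)

/-- The generator of the free group on the edges attached to a step, with its direction. -/
def stepLetter (u v : V) : Sym2 V × Bool := (s(u, v), decide (e u < e v))

theorem stepLetter_symm (he : Function.Injective e) {u v : V} (h : u ≠ v) :
    stepLetter e v u = ((stepLetter e u v).1, !(stepLetter e u v).2) := by
  have := he.ne h
  refine Prod.ext Sym2.eq_swap ?_
  simp only [stepLetter]
  rcases lt_or_gt_of_ne this with h | h
  · simp [h, h.not_gt]
  · simp [h, h.not_gt]

/-- The word read along a sequence of vertices. -/
def seqWord (c : ℕ → V) (m : ℕ) : List (Sym2 V × Bool) :=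
  (List.range m).map fun i => stepLetter e (c i) (c (i + 1))

/-- Consecutive edges of a non-backtracking walk are different generators, so nothing cancels. -/
theorem isReduced_seqWord {c : ℕ → V} (hc : IsNonbacktracking G c) (m : ℕ) :
    FreeGroup.IsReduced (seqWord e c m) := by
  rw [FreeGroup.IsReduced, List.isChain_iff_getElem]
  intro i hi
  simp only [seqWord, List.getElem_map, List.getElem_range, stepLetter]
  intro h
  rcases Sym2.eq_iff.mp h with ⟨h1, -⟩ | ⟨h1, -⟩
  · exact absurd h1 (hc i).1.ne
  · exact absurd h1.symm (hc i).2

/-- The class of a walk in the free group on the edges. -/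
def holonomy : {u v : V} → G.Walk u v → FreeGroup (Sym2 V)
  | _, _, .nil => 1
  | u, _, .cons (v := v) _ p => FreeGroup.mk [stepLetter e u v] * holonomy p

theorem holonomy_append {u v w : V} (p : G.Walk u v) (q : G.Walk v w) :
    holonomy e (p.append q) = holonomy e p * holonomy e q := by
  induction p with
  | nil => simp [holonomy]
  | cons h p ih => simp [holonomy, ih, mul_assoc]

theorem holonomy_cons_cons (he : Function.Injective e) {u v w : V} (h : G.Adj u v)
    (q : G.Walk u w) :
    holonomy e (.cons h (.cons h.symm q)) = holonomy e q := by
  have : FreeGroup.mk [stepLetter e u v] * FreeGroup.mk [stepLetter e v u] = 1 := by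
    rw [stepLetter_symm e he h.ne, mul_eq_one_iff_eq_inv, FreeGroup.inv_mk]
    simp [FreeGroup.invRev]
  rw [holonomy, holonomy, ← mul_assoc, this, one_mul]

theorem holonomy_eq_mk_seqWord {u v : V} (p : G.Walk u v) :
    holonomy e p = FreeGroup.mk (seqWord e p.getVert p.length) := by
  induction p with
  | nil => rfl
  | cons h p ih =>
    rw [holonomy, ih, FreeGroup.mul_mk, SimpleGraph.Walk.length_cons]
    congr 1
    simp [seqWord, List.range_succ_eq_map, Function.comp_def]

theorem holonomy_walkPow {v : V} (p : G.Walk v v) (k : ℕ) :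
    holonomy e (ClosedPath.walkPow p k) = holonomy e p ^ k := by
  induction k with
  | zero => rfl
  | succ k ih => rw [ClosedPath.walkPow, holonomy_append, ih, pow_succ']

theorem holonomy_pow_eq_mk {v : V} (p : G.Walk v v) (k : ℕ) :
    holonomy e p ^ k = FreeGroup.mk (seqWord e (closedSeq p) (k * p.length)) := by
  rw [← holonomy_walkPow, holonomy_eq_mk_seqWord, length_walkPow]
  congr 1
  refine List.map_congr_left fun i hi => ?_
  rw [List.mem_range] at hi
  rw [getVert_walkPow p k hi.le, getVert_walkPow p k hi]

/-- The conjugacy class of the holonomy of a closed path. -/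
def holonomyClass : ClosedPath G → ConjClasses (FreeGroup (Sym2 V)) :=
  Quot.lift (fun p => ConjClasses.mk (holonomy e p.2)) (by
    rintro _ _ ⟨p, q⟩
    rw [ConjClasses.mk_eq_mk_iff_isConj, holonomy_append, holonomy_append, isConj_iff]
    exact ⟨(holonomy e p)⁻¹, by group⟩)

theorem holonomyClass_eq_of_freelyHomotopic (he : Function.Injective e) {γ δ : ClosedPath G}
    (h : γ.FreelyHomotopic δ) : holonomyClass e γ = holonomyClass e δ := by
  induction h with
  | rel a b hab =>
    obtain ⟨p, q, h⟩ := hab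
    change ConjClasses.mk (holonomy e (p.append q)) = ConjClasses.mk (holonomy e (p.append _))
    rw [holonomy_append, holonomy_append, holonomy_cons_cons e he]
  | refl a => rfl
  | symm a b _ ih => exact ih.symm
  | trans a b c _ _ ih1 ih2 => exact ih1.trans ih2

open Classical in
-- Compare word lengths of k-th powers: for p it is exactly k times the length, for q at most that,
-- and conjugation by g costs at most 2|g| independently of k.
theorem length_le_of_isConj_holonomy {v w : V} {p : G.Walk v v} {q : G.Walk w w}
    (hp : IsNonbacktracking G (closedSeq p)) (h : IsConj (holonomy e p) (holonomy e q)) :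
    p.length ≤ q.length := by
  obtain ⟨g, hg⟩ := isConj_iff.mp h
  have key (k : ℕ) : k * p.length ≤ k * q.length + 2 * g.norm := by
    have e1 : (holonomy e p ^ k).norm = k * p.length := by
      rw [holonomy_pow_eq_mk, FreeGroup.norm, FreeGroup.toWord_mk,
        (isReduced_seqWord e hp _).reduce_eq]
      simp [seqWord]
    have e2 : (holonomy e q ^ k).norm ≤ k * q.length := by
      rw [holonomy_pow_eq_mk]
      refine FreeGroup.norm_mk_le.trans ?_
      simp [seqWord]
    have e3 : holonomy e p ^ k = g⁻¹ * holonomy e q ^ k * g := by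
      rw [← hg, conj_pow]; group
    have e4 := (FreeGroup.norm_mul_le (g⁻¹ * holonomy e q ^ k) g).trans
      (Nat.add_le_add_right (FreeGroup.norm_mul_le g⁻¹ (holonomy e q ^ k)) _)
    rw [← e3, FreeGroup.norm_inv_eq, e1] at e4
    omega
  by_contra hlt
  -- If p were longer, this power would gain at least 2|g| + 1, exceeding the error 2|g|.
  have := key (2 * g.norm + 1)
  nlinarith

end Holonomy

/-! ### Primitive geodesics as shift orbits of non-backtracking sequences. -/

section Geodesics

variable {V : Type*} {G : SimpleGraph V}

/-- A backtrack, rotated to the start, is removed by an inverse elementary homotopy and the path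
becomes shorter by 2. -/
theorem isNonbacktracking_of_isClosedGeodesic {v : V} {p : G.Walk v v}
    (h : (ClosedPath.ofWalk p).IsClosedGeodesic) : IsNonbacktracking G (closedSeq p) := by
  have hpos : 0 < p.length := h.1
  refine fun i => ⟨adj_closedSeq p hpos i, fun hi => ?_⟩
  obtain ⟨w, q, hq, hl, hs⟩ := exists_rotation p i
  rw [← hq] at h
  have h2 : closedSeq q 2 = closedSeq q 0 := by
    rw [hs, shift_iterate_apply, shift_iterate_apply, zero_add, add_comm 2, hi]
  rw [closedSeq_zero] at h2
  match q, h, hl, h2 with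
  | .nil, h, _, _ => exact absurd h.1 (lt_irrefl 0)
  | .cons hw .nil, _, _, _ => exact hw.ne rfl
  | .cons (v := x) hx (.cons (v := y) hy r), h, _, h2 =>
    rw [closedSeq_of_le _ (by simp)] at h2
    obtain rfl : y = w := by simpa using h2
    have := h.2 (ClosedPath.ofWalk r)
      (.symm _ _ (.rel _ _ (ClosedPath.ElementaryHomotopy.mk .nil r hx)))
    change r.length + 2 ≤ r.length at this
    omega

theorem isClosedGeodesic_iff [Finite V] {v : V} {p : G.Walk v v} :
    (ClosedPath.ofWalk p).IsClosedGeodesic ↔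
      0 < p.length ∧ IsNonbacktracking G (closedSeq p) := by
  refine ⟨fun h => ⟨h.1, isNonbacktracking_of_isClosedGeodesic h⟩, fun ⟨h0, h⟩ => ⟨h0, ?_⟩⟩
  -- An injective numbering of the vertices orients every edge, as the free-group letters require.
  obtain ⟨n, ⟨f⟩⟩ := Finite.exists_equiv_fin V
  have he : Function.Injective fun v : V => (f v : ℕ) := Fin.val_injective.comp f.injective
  rintro ⟨w, q⟩ hq
  exact length_le_of_isConj_holonomy _ h
    (ConjClasses.mk_eq_mk_iff_isConj.mp (holonomyClass_eq_of_freelyHomotopic _ he hq))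

theorem three_le_length_of_isClosedGeodesic {γ : ClosedPath G} (h : γ.IsClosedGeodesic) :
    3 ≤ γ.length := by
  obtain ⟨⟨v, p⟩⟩ := γ
  have hn := isNonbacktracking_of_isClosedGeodesic (p := p) h
  have hpos : 0 < p.length := h.1
  change 3 ≤ p.length
  by_contra hlt
  have hper := periodic_closedSeq p 0
  obtain h1 | h2 : p.length = 1 ∨ p.length = 2 := by omega
  · rw [h1] at hper
    exact (hn 0).1.ne hper.symm
  · rw [h2] at hper
    exact (hn 0).2 hper

/-- One run through a smaller minimal period is a shorter closed geodesic of which p is a power;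
conversely, a power of q has the length of q as a period. -/
theorem isPrimitiveGeodesic_iff [Finite V] {v : V} {p : G.Walk v v} :
    (ClosedPath.ofWalk p).IsPrimitiveGeodesic ↔ 0 < p.length ∧
      IsNonbacktracking G (closedSeq p) ∧
        Function.minimalPeriod shift (closedSeq p) = p.length := by
  rw [ClosedPath.IsPrimitiveGeodesic, isClosedGeodesic_iff, and_assoc]
  refine and_congr_right fun hpos => and_congr_right fun hn => ?_
  have hper := isPeriodicPt_shift_iff.mpr (periodic_closedSeq p)
  constructor
  · intro h
    by_contra hne
    have hd := hper.minimalPeriod_dvd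
    have hlt := lt_of_le_of_ne (hper.minimalPeriod_le hpos) hne
    have hmpos := hper.minimalPeriod_pos hpos
    have hmper := isPeriodicPt_shift_iff.mp
      (Function.isPeriodicPt_minimalPeriod shift (closedSeq p))
    generalize Function.minimalPeriod shift (closedSeq p) = d at *
    obtain ⟨q, hql, hqs⟩ := exists_closedSeq_eq (fun i => (hn i).1) hmpos hmper
    obtain ⟨k, hk⟩ := hd
    have hk0 : 0 < k := Nat.pos_of_ne_zero (by rintro rfl; omega)
    refine h ⟨ClosedPath.ofWalk q, isClosedGeodesic_iff.mpr ⟨hql ▸ hmpos, by rwa [hqs]⟩, ?_, ?_⟩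
    · change q.length < p.length
      omega
    · refine ⟨_, q, k, rfl, congrArg (Quot.mk _) (sigma_eq_of_closedSeq_eq ?_ ?_)⟩
      · rw [length_walkPow, hql, hk, mul_comm]
      · rw [closedSeq_walkPow q hk0 (hql ▸ hmpos), hqs]
  · rintro hm ⟨δ, hδ, hlt, w, q, k, rfl, hpk⟩
    have hq0 : 0 < q.length := hδ.1
    obtain ⟨hl, s, hs⟩ := exists_shift_of_ofWalk_eq hpk
    rw [length_walkPow] at hl
    have hk0 : 0 < k := Nat.pos_of_ne_zero (by rintro rfl; omega)
    rw [closedSeq_walkPow q hk0 hq0] at hs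
    obtain ⟨t, ht⟩ := exists_shift_symm hpos (periodic_closedSeq p) hs
    have hpq : Function.IsPeriodicPt shift q.length (closedSeq p) := by
      rw [ht]
      exact (isPeriodicPt_shift_iff.mpr (periodic_closedSeq q)).apply_iterate t
    have := hpq.minimalPeriod_le hq0
    rw [hm] at this
    exact absurd hlt (not_lt.mpr this)

theorem ofWalk_out (γ : ClosedPath G) : ClosedPath.ofWalk γ.out.2 = γ := Quot.out_eq γ

/-- The periodic sequence of vertices of a closed path, from some starting vertex. -/
noncomputable def pathSeq (γ : ClosedPath G) : ℕ → V := closedSeq γ.out.2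

theorem mem_primitiveGeodesics_iff [Finite V] {γ : ClosedPath G} {l : ℕ} :
    γ ∈ primitiveGeodesics G l ↔ γ.length = l ∧ 0 < l ∧ IsNonbacktracking G (pathSeq γ) ∧
      Function.minimalPeriod shift (pathSeq γ) = l := by
  have h := isPrimitiveGeodesic_iff (p := γ.out.2)
  have hl : γ.length = γ.out.2.length := congrArg ClosedPath.length (ofWalk_out γ).symm
  rw [ofWalk_out, ← hl] at h
  rw [primitiveGeodesics, Set.mem_ofPred_eq, h, and_comm]
  refine and_congr_right fun e => ?_
  rw [e]
  rfl

theorem periodic_pathSeq (γ : ClosedPath G) : Function.Periodic (pathSeq γ) γ.length := by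
  rw [show γ.length = γ.out.2.length from congrArg ClosedPath.length (ofWalk_out γ).symm]
  exact periodic_closedSeq _

theorem IsNonbacktracking.shift_iterate {c : ℕ → V} (hc : IsNonbacktracking G c) (s : ℕ) :
    IsNonbacktracking G (shift^[s] c) := fun i => by
  have := hc (i + s)
  simp only [shift_iterate_apply]
  rwa [add_right_comm i s 1, add_right_comm i s 2] at this

theorem pathSeq_injOn (l : ℕ) : {γ : ClosedPath G | γ.length = l}.InjOn pathSeq := by
  intro γ hγ δ hδ h
  rw [← ofWalk_out γ, ← ofWalk_out δ]
  refine ofWalk_eq_of_shift (s := 0) ?_ h.symm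
  have h1 : γ.length = γ.out.2.length := congrArg ClosedPath.length (ofWalk_out γ).symm
  have h2 : δ.length = δ.out.2.length := congrArg ClosedPath.length (ofWalk_out δ).symm
  rw [← h1, ← h2]
  exact hγ.trans hδ.symm

/-- The non-backtracking walks of minimal period `l`. -/
def minimalNonbacktracking (G : SimpleGraph V) (l : ℕ) : Set (ℕ → V) :=
  {c | IsNonbacktracking G c ∧ Function.minimalPeriod shift c = l}

/-- With the injectivity below: a sequence of minimal period l is a primitive geodesic with one of
its l distinct starting points. -/
theorem image_primitiveGeodesics_prod [Finite V] {l : ℕ} (hl : 0 < l) :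
    (fun x : ClosedPath G × ℕ => shift^[x.2] (pathSeq x.1)) ''
      (primitiveGeodesics G l ×ˢ Set.Iio l) = minimalNonbacktracking G l := by
  ext c
  constructor
  · rintro ⟨⟨γ, s⟩, ⟨hγ, -⟩, rfl⟩
    obtain ⟨h1, -, h3, h4⟩ := mem_primitiveGeodesics_iff.mp hγ
    refine ⟨h3.shift_iterate s, ?_⟩
    rw [Function.minimalPeriod_apply_iterate, h4]
    exact Function.mk_mem_periodicPts hl (h1 ▸ isPeriodicPt_shift_iff.mpr (periodic_pathSeq γ))
  · rintro ⟨hc, hm⟩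
    have hper : Function.Periodic c l :=
      isPeriodicPt_shift_iff.mp (hm ▸ Function.isPeriodicPt_minimalPeriod shift c)
    obtain ⟨p, hpl, hps⟩ := exists_closedSeq_eq (fun i => (hc i).1) hl hper
    obtain ⟨h1, s, hs⟩ := exists_shift_of_ofWalk_eq (ofWalk_out (ClosedPath.ofWalk p))
    refine ⟨(ClosedPath.ofWalk p, s % l), ⟨?_, Nat.mod_lt s hl⟩, ?_⟩
    · exact ⟨isPrimitiveGeodesic_iff.mpr ⟨hpl ▸ hl, by rwa [hps], by rw [hps, hm, hpl]⟩, hpl⟩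
    · have := periodic_pathSeq (ClosedPath.ofWalk p)
      rw [show (ClosedPath.ofWalk p).length = l from hpl] at this
      exact (shift_iterate_mod this s).trans (hs.symm.trans hps)

theorem injOn_primitiveGeodesics_prod [Finite V] (l : ℕ) :
    (primitiveGeodesics G l ×ˢ Set.Iio l).InjOn
      (fun x : ClosedPath G × ℕ => shift^[x.2] (pathSeq x.1)) := by
  rintro ⟨γ, s⟩ ⟨hγ, hs⟩ ⟨δ, t⟩ ⟨hδ, ht⟩ h
  simp only at hγ hδ h hs ht
  obtain ⟨h1, h2, h3, h4⟩ := mem_primitiveGeodesics_iff.mp hγ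
  obtain ⟨g1, g2, g3, g4⟩ := mem_primitiveGeodesics_iff.mp hδ
  obtain ⟨r, hr⟩ := exists_shift_symm h2 (g1 ▸ periodic_pathSeq δ) h
  rw [← Function.iterate_add_apply] at hr
  obtain rfl : γ = δ := by
    rw [← ofWalk_out γ, ← ofWalk_out δ]
    refine ofWalk_eq_of_shift ?_ hr
    change (ClosedPath.ofWalk γ.out.2).length = (ClosedPath.ofWalk δ.out.2).length
    rw [ofWalk_out, ofWalk_out, h1, g1]
  refine Prod.ext rfl ?_
  exact Function.iterate_injOn_Iio_minimalPeriod (f := shift) (x := pathSeq γ)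
    (by rwa [h4]) (by rwa [h4]) h

theorem ncard_minimalNonbacktracking [Finite V] {l : ℕ} (hl : 0 < l) :
    (minimalNonbacktracking G l).ncard = (primitiveGeodesics G l).ncard * l := by
  rw [← image_primitiveGeodesics_prod hl, (injOn_primitiveGeodesics_prod l).ncard_image,
    Set.ncard_prod, Set.ncard_Iio_nat]

theorem ncard_periodicNonbacktracking [Fintype V] [DecidableRel G.Adj] {m : ℕ} (hm : 0 < m) :
    (periodicNonbacktracking G m).ncard =
      ∑ l ∈ m.divisors, (primitiveGeodesics G l).ncard * l := by
  classical
  have hfin := finite_periodicNonbacktracking G hm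
  rw [Set.ncard_eq_toFinset_card _ hfin, Finset.card_eq_sum_card_fiberwise
    (f := Function.minimalPeriod shift) (t := m.divisors)]
  · refine Finset.sum_congr rfl fun l hl => ?_
    rw [← ncard_minimalNonbacktracking (Nat.pos_of_mem_divisors hl), ← Set.ncard_coe_finset]
    congr 1
    ext c
    simp only [Finset.coe_filter, Set.Finite.mem_toFinset, Set.mem_ofPred_eq,
      minimalNonbacktracking, periodicNonbacktracking]
    refine ⟨fun h => ⟨h.1.1, h.2⟩, fun h => ⟨⟨h.1, ?_⟩, h.2⟩⟩
    rw [← isPeriodicPt_shift_iff, Function.isPeriodicPt_iff_minimalPeriod_dvd, h.2]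
    exact Nat.dvd_of_mem_divisors hl
  · intro c hc
    have hc' : c ∈ periodicNonbacktracking G m := by simpa using hc
    exact Nat.mem_divisors.mpr
      ⟨(isPeriodicPt_shift_iff.mpr hc'.2).minimalPeriod_dvd, hm.ne'⟩

theorem finite_primitiveGeodesics [Fintype V] [DecidableRel G.Adj] (l : ℕ) :
    (primitiveGeodesics G l).Finite := by
  rcases Nat.eq_zero_or_pos l with rfl | hl
  · convert Set.finite_empty
    exact Set.eq_empty_of_forall_notMem fun γ h =>
      lt_irrefl 0 (mem_primitiveGeodesics_iff.mp h).2.1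
  · refine Set.Finite.of_injOn (f := pathSeq) (t := periodicNonbacktracking G l) ?_ ?_
      (finite_periodicNonbacktracking G hl)
    · intro γ h
      obtain ⟨h1, -, h3, -⟩ := mem_primitiveGeodesics_iff.mp h
      exact ⟨h3, h1 ▸ periodic_pathSeq γ⟩
    · exact (pathSeq_injOn l).mono fun γ h => h.2

/-! ### Orientations of primitive geodesics -/

theorem reverse_reverse (γ : ClosedPath G) : γ.reverse.reverse = γ := by
  obtain ⟨⟨v, p⟩⟩ := γ
  change ClosedPath.ofWalk p.reverse.reverse = ClosedPath.ofWalk p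
  rw [SimpleGraph.Walk.reverse_reverse]

theorem isPeriodicPt_of_reverse {v : V} {p : G.Walk v v} (hp : 0 < p.length) {d : ℕ}
    (h : Function.Periodic (closedSeq p) d) : Function.Periodic (closedSeq p.reverse) d := by
  intro i
  rw [closedSeq_reverse p hp, closedSeq_reverse p hp, mul_add]
  exact h.nat_mul _ _

theorem minimalPeriod_closedSeq_reverse {v : V} {p : G.Walk v v} (hp : 0 < p.length) :
    Function.minimalPeriod shift (closedSeq p.reverse) =
      Function.minimalPeriod shift (closedSeq p) := by
  rw [Function.minimalPeriod_eq_minimalPeriod_iff]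
  intro d
  rw [isPeriodicPt_shift_iff, isPeriodicPt_shift_iff]
  refine ⟨fun h => ?_, isPeriodicPt_of_reverse hp⟩
  have := isPeriodicPt_of_reverse (p := p.reverse) (by simpa using hp) h
  rwa [SimpleGraph.Walk.reverse_reverse] at this

theorem isNonbacktracking_closedSeq_reverse {v : V} {p : G.Walk v v} (hp : 0 < p.length)
    (h : IsNonbacktracking G (closedSeq p)) : IsNonbacktracking G (closedSeq p.reverse) := by
  refine fun i => ⟨adj_closedSeq _ (by simpa using hp) i, ?_⟩
  rw [closedSeq_reverse p hp, closedSeq_reverse p hp]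
  have h2 := (h ((p.length - 1) * (i + 2))).2
  intro he
  apply h2
  rw [he, ← periodic_closedSeq p ((p.length - 1) * i), ← periodic_closedSeq p (_ + p.length)]
  congr 1
  obtain ⟨k, hk⟩ : ∃ k, p.length = k + 1 := ⟨p.length - 1, by omega⟩
  rw [hk, Nat.add_sub_cancel]
  ring

theorem reverse_mem_primitiveGeodesics [Finite V] {γ : ClosedPath G} {l : ℕ}
    (h : γ ∈ primitiveGeodesics G l) : γ.reverse ∈ primitiveGeodesics G l := by
  obtain ⟨⟨v, p⟩⟩ := γ
  obtain ⟨h1, h2⟩ := h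
  obtain ⟨hp, hn, hm⟩ := (isPrimitiveGeodesic_iff (p := p)).mp h1
  refine ⟨(isPrimitiveGeodesic_iff (p := p.reverse)).mpr ⟨by simpa using hp,
    isNonbacktracking_closedSeq_reverse hp hn, ?_⟩, ?_⟩
  · rw [minimalPeriod_closedSeq_reverse hp, hm, SimpleGraph.Walk.length_reverse]
  · rw [← h2]
    exact SimpleGraph.Walk.length_reverse p

/-- Otherwise c(ℓ − i) = c(i + t) for some t < ℓ, a reflection of the cycle. If ℓ − t is even it
fixes a position, whose two neighbours coincide, a backtrack; if odd it swaps two adjacent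
positions, giving a loop. -/
theorem reverse_ne_of_isClosedGeodesic {γ : ClosedPath G} (h : γ.IsClosedGeodesic) :
    γ.reverse ≠ γ := by
  obtain ⟨⟨v, p⟩⟩ := γ
  intro he
  have hn := isNonbacktracking_of_isClosedGeodesic (p := p) h
  have hp : 0 < p.length := h.1
  obtain ⟨-, s, hs⟩ := exists_shift_of_ofWalk_eq (p := p) (q := p.reverse) he.symm
  rw [← shift_iterate_mod (periodic_closedSeq p)] at hs
  have hslt := Nat.mod_lt s hp
  generalize s % p.length = t at hs hslt
  have key (i : ℕ) (hi : i ≤ p.length) : closedSeq p (p.length - i) = closedSeq p (i + t) := by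
    rw [← shift_iterate_apply t (closedSeq p) i, ← hs, closedSeq_of_le _ (Nat.sub_le _ _),
      closedSeq_of_le _ (by simpa using hi), SimpleGraph.Walk.getVert_reverse]
  rcases Nat.even_or_odd' (p.length - t) with ⟨k, hk | hk⟩
  · have h1 := key (k - 1) (by omega)
    rw [show p.length - (k - 1) = k - 1 + t + 2 by omega] at h1
    exact (hn (k - 1 + t)).2 h1
  · have h1 := key k (by omega)
    rw [show p.length - k = k + t + 1 by omega] at h1
    exact (hn (k + t)).1.ne h1.symm

theorem ncard_primitiveGeodesics [Fintype V] [DecidableRel G.Adj] (l : ℕ) :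
    (primitiveGeodesics G l).ncard = multiplicity G l * 2 := by
  classical
  have hfin := finite_primitiveGeodesics (G := G) l
  rw [multiplicity, ← hfin.coe_toFinset, ← Finset.coe_image, Set.ncard_coe_finset,
    Set.ncard_coe_finset]
  rw [Finset.card_eq_sum_card_image (fun γ : ClosedPath G => s(γ, γ.reverse)) hfin.toFinset]
  refine Finset.sum_const_nat fun x hx => ?_
  obtain ⟨γ, hγ, rfl⟩ := Finset.mem_image.mp hx
  rw [Set.Finite.mem_toFinset] at hγ
  have hne := reverse_ne_of_isClosedGeodesic hγ.1.1
  rw [← Finset.card_pair hne.symm]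
  congr 1
  ext δ
  simp only [Finset.mem_filter, Set.Finite.mem_toFinset, Finset.mem_insert, Finset.mem_singleton,
    Sym2.eq_iff]
  constructor
  · rintro ⟨-, h | h⟩
    · exact Or.inl h.1
    · exact Or.inr h.1
  · rintro (rfl | rfl)
    · exact ⟨hγ, Or.inl ⟨rfl, rfl⟩⟩
    · exact ⟨reverse_mem_primitiveGeodesics hγ, Or.inr ⟨rfl, reverse_reverse γ⟩⟩

theorem multiplicity_eq_zero_of_lt (G : SimpleGraph V) {l : ℕ} (hl : l < 3) :
    multiplicity G l = 0 := by
  have : primitiveGeodesics G l = ∅ := Set.eq_empty_of_forall_notMem fun γ h =>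
    absurd (h.2 ▸ three_le_length_of_isClosedGeodesic h.1.1) (not_le.mpr hl)
  simp [multiplicity, this]

end Geodesics

/-! ### The trace formula -/

section TraceFormula

/-- The coefficients `I_m(2√2 t) / 2^{m/2}`. -/
noncomputable def traceCoeff (t : ℝ) (m : ℕ) : ℝ := besselI m (2 * √2 * t) / √2 ^ m

theorem FTerm_eq_traceCoeff (l : ℕ) (t : ℝ) (k : ℕ) : FTerm l t k = traceCoeff t (k * l) := by
  rw [FTerm, traceCoeff]
  congr 1
  rw [Real.sqrt_eq_rpow, ← Real.rpow_natCast, ← Real.rpow_mul zero_le_two]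
  congr 1
  push_cast
  ring

theorem summable_abs_traceCoeff_mul_pow (t : ℝ) {y : ℝ} (hy : 0 ≤ y) :
    Summable fun m => |traceCoeff t m| * y ^ m := by
  refine (summable_besselI_mul_pow (2 * √2 * t) (div_nonneg hy (Real.sqrt_nonneg 2))).congr
    fun m => ?_
  rw [traceCoeff, abs_div, abs_of_pos (by positivity : 0 < √2 ^ m), div_pow]
  ring

theorem summable_traceCoeff (t : ℝ) : Summable (traceCoeff t) := by
  refine Summable.of_abs ((summable_abs_traceCoeff_mul_pow t zero_le_one).congr fun m => ?_)
  rw [one_pow, mul_one]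

theorem summable_traceCoeff_mul (t : ℝ) {l : ℕ} (hl : 0 < l) :
    Summable fun k => traceCoeff t (k * l) :=
  (summable_traceCoeff t).comp_injective fun _ _ h => Nat.eq_of_mul_eq_mul_right hl h

theorem summable_FTerm (l : ℕ) (t : ℝ) (hl : 0 < l) :
    Summable fun k : {k : ℕ // 1 ≤ k} => FTerm l t k := by
  simp only [FTerm_eq_traceCoeff]
  exact (summable_traceCoeff_mul t hl).comp_injective
    (i := fun k : {k : ℕ // 1 ≤ k} => (k : ℕ)) Subtype.val_injective

/-- The positive integers as a subtype. -/
def pnatEquiv : ℕ+ ≃ {k : ℕ // 1 ≤ k} where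
  toFun k := ⟨k, k.2⟩
  invFun k := ⟨k, k.2⟩
  left_inv _ := rfl
  right_inv _ := rfl

theorem hasSum_F (l : ℕ+) (t : ℝ) :
    HasSum (fun k : ℕ+ => traceCoeff t (k * l)) (F l t) := by
  have h := pnatEquiv.hasSum_iff.mpr (summable_FTerm l t l.pos).hasSum
  refine h.congr_fun fun k => ?_
  exact (FTerm_eq_traceCoeff l t k).symm

/-- The even coefficients sum to the difference of `I₀` and `J`. -/
theorem hasSum_traceCoeff_even (t : ℝ) :
    HasSum (fun m : ℕ => if Even (m + 1) then traceCoeff t (m + 1) else 0)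
      (besselI 0 (2 * √2 * t) - J t) := by
  have hinj : Function.Injective fun j : ℕ => 2 * j + 1 := fun a b h => by
    simp only at h; omega
  refine (hinj.hasSum_iff fun m hm => ?_).mp ?_
  · rw [if_neg]
    rintro ⟨r, hr⟩
    exact hm ⟨r - 1, by simp only; omega⟩
  · refine (hasSum_besselI_even t).congr_fun fun j => ?_
    rw [Function.comp_apply, if_pos ⟨j + 1, by ring⟩, traceCoeff,
      show 2 * j + 1 + 1 = 2 * (j + 1) by ring, pow_mul, Real.sq_sqrt zero_le_two]

variable {V : Type*} [Fintype V] (G : SimpleGraph V)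

theorem ncard_periodicNonbacktracking_le {m : ℕ} (hm : 0 < m) :
    (periodicNonbacktracking G m).ncard ≤ Fintype.card V ^ m := by
  have h : (periodicNonbacktracking G m).InjOn fun c (i : Fin m) => c i := by
    intro c hc d hd h
    funext i
    rw [← hc.2.map_mod_nat i, ← hd.2.map_mod_nat i]
    exact congrFun h ⟨i % m, Nat.mod_lt i hm⟩
  rw [← h.ncard_image]
  refine (Set.ncard_le_card _).trans_eq ?_
  simp

/-- The crude bound n^m on the number of sequences is enough, given the decay of the Bessel
coefficients. -/
theorem summable_abs_traceCoeff_mul_ncard (t : ℝ) :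
    Summable fun m : ℕ+ => |traceCoeff t m| * (periodicNonbacktracking G m).ncard := by
  refine Summable.of_nonneg_of_le (fun m => by positivity) (fun m => ?_)
    ((summable_abs_traceCoeff_mul_pow t (Nat.cast_nonneg (Fintype.card V))).comp_injective
      PNat.coe_injective)
  have := ncard_periodicNonbacktracking_le G m.pos
  simp only [Function.comp_apply]
  gcongr
  exact_mod_cast this

variable [DecidableRel G.Adj]

theorem sum_divisorsAntidiagonal_primitive (m : ℕ+) :
    ∑ x ∈ (m : ℕ).divisorsAntidiagonal, ((primitiveGeodesics G x.1).ncard * x.1 : ℝ) =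
      (periodicNonbacktracking G m).ncard := by
  rw [ncard_periodicNonbacktracking m.pos, Nat.sum_divisorsAntidiagonal
    (fun l _ => ((primitiveGeodesics G l).ncard * l : ℝ))]
  push_cast
  rfl

variable [DecidableEq V]

/-- The Dickson expansion summed over the spectrum carries −n·I_0; adding n times the even series
accounts for the parity term in the walk count and replaces I_0 by J. -/
theorem hasSum_traceCoeff_mul_ncard (hG : G.IsRegularOfDegree 3) (t : ℝ) :
    HasSum (fun m : ℕ => traceCoeff t (m + 1) * (periodicNonbacktracking G (m + 1)).ncard)
      (∑ i, Real.exp (t * eigenvalue G i) - Fintype.card V * J t) := by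
  have h1 := hasSum_sum (s := Finset.univ)
    fun i _ => hasSum_besselI_dickson t (eigenvalue G i)
  have h2 := h1.add ((hasSum_traceCoeff_even t).mul_left (Fintype.card V : ℝ))
  rw [Finset.sum_sub_distrib, Finset.sum_const, Finset.card_univ, nsmul_eq_mul, mul_sub,
    sub_add_sub_cancel] at h2
  refine h2.congr_fun fun m => ?_
  rw [card_periodicNonbacktracking G hG, trace_aeval_adjMatrix, ← Finset.mul_sum, traceCoeff]
  split_ifs <;> ring

/-- The terms of the double series of the trace formula. -/
noncomputable def traceTerm (t : ℝ) (x : ℕ+ × ℕ+) : ℝ :=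
  traceCoeff t (x.2 * x.1) * ((primitiveGeodesics G x.1).ncard * (x.1 : ℕ))

/-- Grouping the pairs (l, k) by m = kl turns the double series into the series over walk counts;
nonnegativity of the counts reduces absolute convergence to that single series. -/
theorem hasSum_traceTerm (hG : G.IsRegularOfDegree 3) (t : ℝ) :
    HasSum (traceTerm G t) (∑ i, Real.exp (t * eigenvalue G i) - Fintype.card V * J t) := by
  have hval (m : ℕ+) (x : (m : ℕ).divisorsAntidiagonal) :
      traceTerm G t (sigmaAntidiagonalEquivProd ⟨m, x⟩) =
        traceCoeff t m * ((primitiveGeodesics G x.1.1).ncard * (x.1.1 : ℕ)) := by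
    have : x.1.2 * x.1.1 = m := by
      rw [mul_comm]; exact (Nat.mem_divisorsAntidiagonal.mp x.2).1
    exact congrArg (fun n => traceCoeff t n * ((primitiveGeodesics G x.1.1).ncard * (x.1.1 : ℕ)))
      this
  have hs : Summable (traceTerm G t ∘ sigmaAntidiagonalEquivProd) := by
    refine Summable.of_abs ((summable_sigma_of_nonneg fun _ => abs_nonneg _).mpr
      ⟨fun m => Summable.of_finite, ?_⟩)
    refine (summable_abs_traceCoeff_mul_ncard G t).congr fun m => ?_
    rw [← sum_divisorsAntidiagonal_primitive, Finset.mul_sum, tsum_fintype,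
      ← Finset.sum_coe_sort (m : ℕ).divisorsAntidiagonal]
    refine Finset.sum_congr rfl fun x _ => ?_
    rw [Function.comp_apply, hval, abs_mul,
      abs_of_nonneg (by positivity : (0 : ℝ) ≤ (primitiveGeodesics G x.1.1).ncard * (x.1.1 : ℕ))]
  have h1 : HasSum (fun m : ℕ+ => traceCoeff t m * (periodicNonbacktracking G m).ncard) _ :=
    hs.hasSum.sigma fun m => by
      rw [← sum_divisorsAntidiagonal_primitive, Finset.mul_sum,
        ← Finset.sum_coe_sort (m : ℕ).divisorsAntidiagonal]
      refine (hasSum_fintype _).congr_fun fun x => ?_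
      exact hval m x
  have h2 := h1.unique (Equiv.pnatEquivNat.symm.hasSum_iff.mp (hasSum_traceCoeff_mul_ncard G hG t))
  rw [← sigmaAntidiagonalEquivProd.hasSum_iff, ← h2]
  exact hs.hasSum

/-- The trace formula, as a sum over lengths. -/
theorem hasSum_mul_multiplicity_mul_F (hG : G.IsRegularOfDegree 3) (t : ℝ) :
    HasSum (fun l : {l : ℕ // 3 ≤ l} => (l : ℝ) * (multiplicity G l : ℝ) * F l t)
      ((∑ i, Real.exp (t * eigenvalue G i) - Fintype.card V * J t) / 2) := by
  -- The same double series is now summed over k for fixed l. The later division by 2 passes from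
  -- oriented to non-oriented geodesics.
  have h1 : HasSum (fun l : ℕ+ => F l t * ((primitiveGeodesics G l).ncard * (l : ℕ))) _ :=
    (hasSum_traceTerm G hG t).prod_fiberwise fun l => (hasSum_F l t).mul_right _
  have h2 := h1.div_const 2
  have hinj : Function.Injective fun l : {l : ℕ // 3 ≤ l} =>
      (⟨l, lt_of_lt_of_le (by norm_num) l.2⟩ : ℕ+) := fun a b h =>
    Subtype.ext (congrArg PNat.val h)
  have h3 := (hinj.hasSum_iff (fun l hl => ?_)).mpr h2
  · refine h3.congr_fun fun l => ?_
    change _ = F l t * ((primitiveGeodesics G l).ncard * (l : ℕ)) / 2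
    rw [ncard_primitiveGeodesics]
    push_cast
    ring
  · rw [ncard_primitiveGeodesics, multiplicity_eq_zero_of_lt, zero_mul, Nat.cast_zero, zero_mul,
      mul_zero, zero_div]
    by_contra h
    exact hl ⟨⟨l, not_lt.mp h⟩, rfl⟩

theorem expAverage_eq [Nonempty V] (hG : G.IsRegularOfDegree 3) (t : ℝ) :
    expAverage G t = J t + 2 / (Fintype.card V : ℝ) * ∑' l : {l : ℕ // 3 ≤ l},
      (l : ℝ) * (multiplicity G l : ℝ) * F l t := by
  rw [(hasSum_mul_multiplicity_mul_F G hG t).tsum_eq, expAverage]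
  have : (Fintype.card V : ℝ) ≠ 0 := by positivity
  field_simp
  ring

theorem mean_eq_expAverage : mean G = expAverage G (1 / 3) := by
  unfold mean expAverage
  congr 1
  exact Finset.sum_congr rfl fun i _ => by congr 1; ring

theorem variance_eq [Nonempty V] : variance G = expAverage G (2 / 3) - mean G ^ 2 := by
  have hn : (Fintype.card V : ℝ) ≠ 0 := by positivity
  have hm : ∑ i, Real.exp (eigenvalue G i / 3) = Fintype.card V * mean G := by
    rw [mean]; field_simp
  have hsq (i : V) : (Real.exp (eigenvalue G i / 3) - mean G) ^ 2 =
      Real.exp (2 / 3 * eigenvalue G i) - 2 * mean G * Real.exp (eigenvalue G i / 3) +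
        mean G ^ 2 := by
    rw [show 2 / 3 * eigenvalue G i = eigenvalue G i / 3 + eigenvalue G i / 3 by ring,
      Real.exp_add]
    ring
  rw [variance, expAverage, Finset.sum_congr rfl fun i _ => hsq i, Finset.sum_add_distrib,
    Finset.sum_sub_distrib, ← Finset.mul_sum, hm]
  simp only [Finset.sum_const, Finset.card_univ, nsmul_eq_mul]
  field_simp
  ring

end TraceFormula

end CubicTrace

theorem mainTheorem1 {V : Type*} [Fintype V] [DecidableEq V] [Nonempty V]
    (G : SimpleGraph V) [DecidableRel G.Adj] (hG : G.IsRegularOfDegree 3) :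
    -- all objects in the formula are well defined
    (∀ γ : CubicTrace.ClosedPath G, γ.IsClosedGeodesic → 3 ≤ γ.length) ∧
    (∀ ℓ : ℕ, (CubicTrace.primitiveGeodesics G ℓ).Finite) ∧
    (∀ (m : ℕ) (z : ℝ), Summable (CubicTrace.besselITerm m z)) ∧
    (∀ t : ℝ, IntervalIntegrable (CubicTrace.JIntegrand t) MeasureTheory.volume
      (-(2 * √2)) (2 * √2)) ∧
    (∀ (ℓ : ℕ) (t : ℝ), 3 ≤ ℓ →
      Summable (fun k : {k : ℕ // 1 ≤ k} => CubicTrace.FTerm ℓ t k)) ∧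
    (∀ t : ℝ, Summable (fun ℓ : {ℓ : ℕ // 3 ≤ ℓ} =>
      (ℓ : ℝ) * (CubicTrace.multiplicity G ℓ : ℝ) * CubicTrace.F ℓ t)) ∧
    -- the trace formula
    (∀ t : ℝ, CubicTrace.expAverage G t = CubicTrace.J t +
      2 / (Fintype.card V : ℝ) * ∑' ℓ : {ℓ : ℕ // 3 ≤ ℓ},
        (ℓ : ℝ) * (CubicTrace.multiplicity G ℓ : ℝ) * CubicTrace.F ℓ t) ∧
    -- the mean
    CubicTrace.mean G = CubicTrace.J (1 / 3) +
      2 / (Fintype.card V : ℝ) * ∑' ℓ : {ℓ : ℕ // 3 ≤ ℓ},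
        (ℓ : ℝ) * (CubicTrace.multiplicity G ℓ : ℝ) * CubicTrace.F ℓ (1 / 3) ∧
    -- the variance
    CubicTrace.variance G = CubicTrace.J (2 / 3) +
      2 / (Fintype.card V : ℝ) * (∑' ℓ : {ℓ : ℕ // 3 ≤ ℓ},
        (ℓ : ℝ) * (CubicTrace.multiplicity G ℓ : ℝ) * CubicTrace.F ℓ (2 / 3)) -
      CubicTrace.mean G ^ 2 ∧
    -- the variance, with the part linear in the multiplicities and the quadratic term separated
    CubicTrace.variance G = (CubicTrace.J (2 / 3) - CubicTrace.J (1 / 3) ^ 2) +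
      2 / (Fintype.card V : ℝ) * (∑' ℓ : {ℓ : ℕ // 3 ≤ ℓ},
        (ℓ : ℝ) * (CubicTrace.multiplicity G ℓ : ℝ) *
          (CubicTrace.F ℓ (2 / 3) - 2 * CubicTrace.J (1 / 3) * CubicTrace.F ℓ (1 / 3))) -
      (2 / (Fintype.card V : ℝ) * ∑' ℓ : {ℓ : ℕ // 3 ≤ ℓ},
        (ℓ : ℝ) * (CubicTrace.multiplicity G ℓ : ℝ) * CubicTrace.F ℓ (1 / 3)) ^ 2 := by
  have hs := fun t => (CubicTrace.hasSum_mul_multiplicity_mul_F G hG t).summable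
  have hmean := CubicTrace.mean_eq_expAverage G
  have hvar := CubicTrace.variance_eq G
  rw [CubicTrace.expAverage_eq G hG] at hmean hvar
  refine ⟨fun γ => CubicTrace.three_le_length_of_isClosedGeodesic,
    CubicTrace.finite_primitiveGeodesics, CubicTrace.summable_besselITerm,
    CubicTrace.intervalIntegrable_JIntegrand,
    fun l t hl => CubicTrace.summable_FTerm l t (by omega), hs, CubicTrace.expAverage_eq G hG,
    hmean, hvar, ?_⟩
  -- In the square of the mean, the cross term with J(1/3) is linear in the multiplicities and joins
  -- the series for 2/3.
  have hsplit : ∑' l : {l : ℕ // 3 ≤ l}, (l : ℝ) * (CubicTrace.multiplicity G l : ℝ) *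
      (CubicTrace.F l (2 / 3) - 2 * CubicTrace.J (1 / 3) * CubicTrace.F l (1 / 3)) =
      (∑' l : {l : ℕ // 3 ≤ l},
        (l : ℝ) * (CubicTrace.multiplicity G l : ℝ) * CubicTrace.F l (2 / 3)) -
      2 * CubicTrace.J (1 / 3) * ∑' l : {l : ℕ // 3 ≤ l},
        (l : ℝ) * (CubicTrace.multiplicity G l : ℝ) * CubicTrace.F l (1 / 3) := by
    rw [← tsum_mul_left, ← (hs (2 / 3)).tsum_sub ((hs (1 / 3)).mul_left _)]
    exact tsum_congr fun l => by ring
  rw [hvar, hmean, hsplit]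
  ring
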